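/- Let $n\ge 3$. A finite simple graph is \emph{planar} if it can be embedded in the plane, with distinct points as vertices and simple arcs as edges that meet only in common endpoints. A planar graph is \emph{maximal planar} if no edge can be added between two of its vertices without destroying planarity; it is a \emph{triangulation of the sphere} if it has an embedding in the plane in which every face, including the unbounded one, is bounded by a 3-cycle of the graph. A \emph{3-clique} is a set of three pairwise adjacent vertices. The maximum number of 3-cliques in a maximal planar graph with $n$ vertices is $C_3^{\max}(P_n)=3n-8$. That is, every graph with $n$ vertices that is maximal planar, or is a triangulation of the sphere, has at most $3n-8$ 3-cliques, and there is a graph with $n$ vertices, both maximal planar and a triangulation of the sphere, that has exactly $3n-8$ of them. -/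

import Mathlib

/-- The Euclidean plane. -/
abbrev Plane : Type := EuclideanSpace ℝ (Fin 2)

/-- An embedding of a simple graph in the plane: the vertices are distinct points, every edge is a
simple arc joining its two endpoints, an edge passes through no vertex but its endpoints, and two
different edges meet only in vertices (which are then common endpoints). -/
structure PlaneDrawing {V : Type*} (G : SimpleGraph V) where
  /-- The point that represents a vertex. -/
  pt : V → Plane
  pt_injective : Function.Injective pt
  /-- The closed arc (a subset of the plane) that represents an edge. -/
  arc : G.edgeSet → Set Plane
  arc_isArc : ∀ (u v : V) (h : G.Adj u v),
    ∃ γ : Path (pt u) (pt v), Function.Injective γ ∧ Set.range γ = arc ⟨s(u, v), h⟩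
  mem_of_pt_mem_arc : ∀ (e : G.edgeSet) (w : V), pt w ∈ arc e → w ∈ (e : Sym2 V)
  arc_inter_arc : ∀ e f : G.edgeSet, e ≠ f → arc e ∩ arc f ⊆ Set.range pt

namespace PlaneDrawing

variable {V : Type*} {G : SimpleGraph V}

/-- The set of all points of the plane that lie on the drawing. -/
def support (D : PlaneDrawing G) : Set Plane :=
  Set.range D.pt ∪ ⋃ e, D.arc e

/-- A face is a connected component of the complement of the drawing. The unbounded component is
a face, too. -/
def IsFace (D : PlaneDrawing G) (F : Set Plane) : Prop :=
  ∃ p ∈ D.supportᶜ, F = connectedComponentIn D.supportᶜ p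

/-- The set `F` is bounded by a triangle: its boundary consists exactly of the three edges of
a 3-cycle `a b c` of the graph. -/
def IsBoundedByTriangle (D : PlaneDrawing G) (F : Set Plane) : Prop :=
  ∃ (a b c : V) (hab : G.Adj a b) (hbc : G.Adj b c) (hca : G.Adj c a),
    frontier F = D.arc ⟨s(a, b), hab⟩ ∪ D.arc ⟨s(b, c), hbc⟩ ∪ D.arc ⟨s(c, a), hca⟩

end PlaneDrawing

/-- A graph is planar if it can be embedded in the plane. -/
def IsPlanarGraph {V : Type*} (G : SimpleGraph V) : Prop :=
  Nonempty (PlaneDrawing G)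

/-- A graph is maximal planar if it is planar and no edge can be added to it, between two of its
vertices, without destroying planarity. -/
def IsMaximalPlanarGraph {V : Type*} (G : SimpleGraph V) : Prop :=
  Maximal (fun H : SimpleGraph V => IsPlanarGraph H) G

/-- A graph is a triangulation of the sphere (the plane with a point at infinity) if it can be
embedded so that every face, the unbounded one included, is bounded by a triangle. -/
def IsSphereTriangulation {V : Type*} (G : SimpleGraph V) : Prop :=
  ∃ D : PlaneDrawing G, ∀ F : Set Plane, D.IsFace F → D.IsBoundedByTriangle F

/-- The number of 3-cliques of a finite graph. -/
noncomputable def numThreeCliques {V : Type*} (G : SimpleGraph V) : ℕ :=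
  (G.cliqueSet 3).ncard

/-!
The upper bound holds for every planar graph, and it follows from the absence of a complete minor
on five vertices.

*Combinatorics.* Let `G` have no complete minor on five vertices, and let `v` be a vertex with a
neighbour. The neighbourhood of `v` has no complete minor on four vertices, so it contains a vertex
`u` with at most two neighbours in it (`SimpleGraph.hasCliqueMinorIn_four`, by a longest path
argument). Thus `u` and `v` have at most two common neighbours, and contracting `u` into `v` destroys
at most three triangles (`SimpleGraph.ncard_cliqueSet_le_contractInto`). Induction on the number of
vertices gives at most `3 * n - 8` triangles, starting from the single triangle on three vertices.

*Topology.* A complete minor on five vertices in a plane drawing yields five points of the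
plane and paths between any two of them, such that the paths of disjoint pairs do not meet. This is
impossible by a winding number argument (`no_almost_embedding_K5`), which needs only continuous
logarithms and applies to arbitrary continuous arcs, so no Jordan curve theorem is involved.

*Extremal graph.* The join of an edge and a path on `n - 2` vertices (`doubleFan`) has `3 * n - 8`
triangles. It has a straight-line drawing with the path on the vertical axis, whose faces are
open triangles and the exterior of a triangle. These are identified through barycentric coordinates.
Since one of its vertices is adjacent to all the others, any further edge would create a
further triangle, so the upper bound itself shows that the graph is maximal planar.
-/

/-! ### Continuous logarithms -/

theorem exists_continuous_log {X : Type*} [TopologicalSpace X] [SimplyConnectedSpace X]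
    [LocallyPathConnectedSpace X] {f : X → ℂ} (hf : Continuous f) (h0 : ∀ x, f x ≠ 0) :
    ∃ L : X → ℂ, Continuous L ∧ ∀ x, Complex.exp (L x) = f x := by
  obtain ⟨a⟩ : Nonempty X := inferInstance
  obtain ⟨F, ⟨-, hF⟩, -⟩ := Complex.isCoveringMapOn_exp.existsUnique_continuousMap_lifts
    (f := ⟨f, hf⟩) (a₀ := a) (e₀ := Complex.log (f a)) (by simp [Complex.exp_log (h0 a)])
    (by intro x; simpa using h0 x)
  exact ⟨F, F.continuous, fun x => congrFun hF x⟩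

theorem eq_of_exp_comp_eq {D : ℝ → ℂ} (hD : Continuous D) {c : ℂ}
    (h : ∀ s, Complex.exp (D s) = c) (s t : ℝ) : D s = D t := by
  have := Complex.isCoveringMap_exp.eq_of_comp_eq hD (continuous_const (y := D t))
    (by ext x; simp [h]) t rfl
  exact congrFun this s

/-- Logarithms of two proportional functions have the same increments. -/
theorem log_increment_eq {A B : ℝ → ℂ} (hA : Continuous A) (hB : Continuous B) {c : ℂ}
    (h : ∀ s, Complex.exp (A s) = c * Complex.exp (B s)) : A 1 - A 0 = B 1 - B 0 := by
  have := eq_of_exp_comp_eq (D := fun s => A s - B s) (hA.sub hB) (c := c)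
    (fun s => by rw [Complex.exp_sub, h, mul_div_cancel_right₀ _ (Complex.exp_ne_zero _)]) 1 0
  linear_combination this

/-! ### Five points in the plane cannot be joined without independent crossings -/

/-- The increments of the logarithm of `f s - g t` along the boundary of the unit square add up
to zero. -/
theorem log_increment_square {f g : ℝ → ℂ} (hf : Continuous f) (hg : Continuous g)
    (hfg : ∀ s t, f s ≠ g t) {A₀ A₁ B₀ B₁ : ℝ → ℂ} (hA₀ : Continuous A₀) (hA₁ : Continuous A₁)
    (hB₀ : Continuous B₀) (hB₁ : Continuous B₁)
    (eA₀ : ∀ s, Complex.exp (A₀ s) = f s - g 0) (eA₁ : ∀ s, Complex.exp (A₁ s) = f s - g 1)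
    (eB₀ : ∀ t, Complex.exp (B₀ t) = g t - f 0) (eB₁ : ∀ t, Complex.exp (B₁ t) = g t - f 1) :
    (A₀ 1 - A₀ 0) + (B₁ 1 - B₁ 0) - (A₁ 1 - A₁ 0) - (B₀ 1 - B₀ 0) = 0 := by
  obtain ⟨S, hS, eS⟩ := exists_continuous_log (X := ℝ × ℝ) (f := fun x => f x.1 - g x.2)
    (by fun_prop) (fun x => sub_ne_zero.2 (hfg _ _))
  have h1 := log_increment_eq (A := fun s => S (s, 0)) (c := 1) (by fun_prop) hA₀
    (fun s => by rw [eS, eA₀, one_mul])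
  have h2 := log_increment_eq (A := fun s => S (s, 1)) (c := 1) (by fun_prop) hA₁
    (fun s => by rw [eS, eA₁, one_mul])
  have h3 := log_increment_eq (A := fun s => S (0, s)) (c := -1) (by fun_prop) hB₀
    (fun s => by rw [eS, eB₀]; ring)
  have h4 := log_increment_eq (A := fun s => S (1, s)) (c := -1) (by fun_prop) hB₁
    (fun s => by rw [eS, eB₁]; ring)
  rw [← h1, ← h2, ← h3, ← h4]
  ring

/-- The van Kampen–Flores theorem for the complete graph on five vertices, in the plane: if any two
of five points are joined by a path, then the paths of some two disjoint pairs meet.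

Otherwise, choose logarithms `Θ k i` of `p i - p k`. Along the path from `p i` to `p j`, the
logarithm of the difference to `p k` increases by `Θ k j - Θ k i` plus `m k i j` full turns. For
disjoint pairs `i j` and `k l`, `log_increment_square` gives a linear relation between four of
the integers `m`. In the sum over all fifteen unordered pairs of disjoint edges every `m` occurs
exactly twice, so the sum of the constants `σ k j - σ k i - σ l j + σ l i` is divisible by four. Such
a constant is `±2` if the chords `i j` and `k l` of a convex pentagon cross, and `0` or `±4`
otherwise. Since five pairs of chords cross, this is impossible. -/
theorem no_almost_embedding_K5 (p : Fin 5 → ℂ) (g : Fin 5 → Fin 5 → ℝ → ℂ)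
    (hc : ∀ i j, i ≠ j → Continuous (g i j)) (h0 : ∀ i j, i ≠ j → g i j 0 = p i)
    (h1 : ∀ i j, i ≠ j → g i j 1 = p j)
    (hd : ∀ i j k l, [i, j, k, l].Nodup → ∀ s t, g i j s ≠ g k l t) : False := by
  have hex : ∀ k i j : Fin 5, [k, i, j].Nodup → ∃ l, [i, j, k, l].Nodup := by decide
  have hgp : ∀ k i j : Fin 5, [k, i, j].Nodup → ∀ s, g i j s - p k ≠ 0 := by
    intro k i j h s
    obtain ⟨l, hl⟩ := hex k i j h
    have hkl : k ≠ l := by simp at hl; tauto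
    rw [← h0 k l hkl]
    exact sub_ne_zero.2 (hd i j k l hl s 0)
  have hpp : ∀ k i : Fin 5, k ≠ i → p i - p k ≠ 0 := by
    intro k i h
    have : ∃ j, [k, i, j].Nodup := by revert k i; decide
    obtain ⟨j, hj⟩ := this
    have hij : i ≠ j := by simp at hj; tauto
    have := hgp k i j hj 0
    rwa [h0 i j hij] at this
  have hL : ∀ k i j : Fin 5, ∃ L : ℝ → ℂ, [k, i, j].Nodup →
      Continuous L ∧ ∀ s, Complex.exp (L s) = g i j s - p k := by
    intro k i j
    by_cases h : [k, i, j].Nodup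
    · have hij : i ≠ j := by simp at h; tauto
      obtain ⟨L, hL⟩ := exists_continuous_log (f := fun s => g i j s - p k)
        ((hc i j hij).sub continuous_const) (hgp k i j h)
      exact ⟨L, fun _ => hL⟩
    · exact ⟨0, fun h' => absurd h' h⟩
  choose L hL using hL
  -- logarithms of `p i - p k` for both orders of `i` and `k`, half a turn apart
  have hΘ : ∃ Θ : Fin 5 → Fin 5 → ℂ, (∀ k i, k ≠ i → Complex.exp (Θ k i) = p i - p k) ∧
      ∀ k i, k < i → Θ i k = Θ k i + Real.pi * Complex.I := by
    refine ⟨fun k i => if k < i then Complex.log (p i - p k)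
      else Complex.log (p k - p i) + Real.pi * Complex.I, ?_, ?_⟩
    · intro k i h
      by_cases hki : k < i
      · simp only [hki, if_true]
        exact Complex.exp_log (hpp k i h)
      · simp only [hki, if_false]
        rw [Complex.exp_add, Complex.exp_log (hpp i k h.symm), Complex.exp_pi_mul_I]
        ring
    · intro k i h
      simp [h, h.not_gt]
  obtain ⟨Θ, hΘ, hΘ'⟩ := hΘ
  have hm : ∀ k i j : Fin 5, ∃ m : ℤ, [k, i, j].Nodup →
      L k i j 1 - L k i j 0 = Θ k j - Θ k i + m * (2 * Real.pi * Complex.I) := by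
    intro k i j
    by_cases h : [k, i, j].Nodup
    · have hij : i ≠ j := by simp at h; tauto
      have hki : k ≠ i := by simp at h; tauto
      have hkj : k ≠ j := by simp at h; tauto
      have e := (hL k i j h).2
      have : Complex.exp (L k i j 1 - L k i j 0) = Complex.exp (Θ k j - Θ k i) := by
        rw [Complex.exp_sub, Complex.exp_sub, e, e, hΘ k j hkj, hΘ k i hki, h0 i j hij, h1 i j hij]
      obtain ⟨m, hm⟩ := Complex.exp_eq_exp_iff_exists_int.1 this
      exact ⟨m, fun _ => hm⟩
    · exact ⟨0, fun h' => absurd h' h⟩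
  choose m hm using hm
  let σ : Fin 5 → Fin 5 → ℤ := fun k i => if i < k then 1 else -1
  have hσ : ∀ k i, k ≠ i → Θ k i - Θ i k = (σ k i : ℂ) * (Real.pi * Complex.I) := by
    intro k i h
    rcases lt_or_gt_of_ne h with h | h
    · simp [σ, h.not_gt, hΘ' k i h]
    · simp [σ, h, hΘ' i k h]
  have key : ∀ i j k l : Fin 5, [i, j, k, l].Nodup →
      σ k j - σ k i - σ l j + σ l i + 2 * (m k i j + m j k l - m l i j - m i k l) = 0 := by
    intro i j k l h
    have hij : i ≠ j := by simp at h; tauto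
    have hik : k ≠ i := by simp at h; tauto
    have hil : l ≠ i := by simp at h; tauto
    have hjk : k ≠ j := by simp at h; tauto
    have hjl : l ≠ j := by simp at h; tauto
    have hkl : k ≠ l := by simp at h; tauto
    have a1 : [k, i, j].Nodup := by simp; tauto
    have a2 : [l, i, j].Nodup := by simp; tauto
    have a3 : [i, k, l].Nodup := by simp; tauto
    have a4 : [j, k, l].Nodup := by simp; tauto
    have sq := log_increment_square (hc i j hij) (hc k l hkl) (hd i j k l h)
      (hL k i j a1).1 (hL l i j a2).1 (hL i k l a3).1 (hL j k l a4).1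
      (by rw [h0 k l hkl]; exact (hL k i j a1).2) (by rw [h1 k l hkl]; exact (hL l i j a2).2)
      (by rw [h0 i j hij]; exact (hL i k l a3).2) (by rw [h1 i j hij]; exact (hL j k l a4).2)
    rw [hm k i j a1, hm l i j a2, hm i k l a3, hm j k l a4] at sq
    have e1 := hσ k j hjk
    have e2 := hσ k i hik
    have e3 := hσ l j hjl
    have e4 := hσ l i hil
    have hpi : (Real.pi * Complex.I : ℂ) ≠ 0 := by simp [Real.pi_ne_zero]
    have : ((σ k j - σ k i - σ l j + σ l i + 2 * (m k i j + m j k l - m l i j - m i k l) : ℤ) : ℂ)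
        * (Real.pi * Complex.I) = 0 := by
      push_cast
      linear_combination sq - e1 + e2 + e3 - e4
    exact_mod_cast (mul_eq_zero.1 this).resolve_right hpi
  -- the relations for all fifteen pairs of disjoint edges have no common integer solution
  have q1 := key 0 1 2 3 (by decide)
  have q2 := key 0 1 2 4 (by decide)
  have q3 := key 0 1 3 4 (by decide)
  have q4 := key 0 2 1 3 (by decide)
  have q5 := key 0 2 1 4 (by decide)
  have q6 := key 0 2 3 4 (by decide)
  have q7 := key 0 3 1 2 (by decide)
  have q8 := key 0 3 1 4 (by decide)
  have q9 := key 0 3 2 4 (by decide)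
  have q10 := key 0 4 1 2 (by decide)
  have q11 := key 0 4 1 3 (by decide)
  have q12 := key 0 4 2 3 (by decide)
  have q13 := key 1 2 3 4 (by decide)
  have q14 := key 1 3 2 4 (by decide)
  have q15 := key 1 4 2 3 (by decide)
  simp [σ] at q1 q2 q3 q4 q5 q6 q7 q8 q9 q10 q11 q12 q13 q14 q15
  omega

/-! ### Complete minors -/

namespace SimpleGraph

variable {V : Type*}

/-- The vertex set `B` induces a connected (possibly empty) subgraph of `G`: any two of its
vertices are joined by a walk inside `B`. -/
def ConnectedOn (G : SimpleGraph V) (B : Set V) : Prop :=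
  ∀ x ∈ B, ∀ y ∈ B, Relation.ReflTransGen (fun a b => G.Adj a b ∧ a ∈ B ∧ b ∈ B) x y

/-- `G` has a complete minor on `k` vertices with all branch sets inside `S`: there are `k` disjoint
connected subsets of `S`, any two of them joined by an edge. The branch sets are not
required to be nonempty, because for `k ≥ 2` the joining edges force this. -/
def HasCliqueMinorIn (G : SimpleGraph V) (k : ℕ) (S : Set V) : Prop :=
  ∃ B : Fin k → Set V, (∀ i, B i ⊆ S) ∧ (∀ i j, i ≠ j → Disjoint (B i) (B j)) ∧
    (∀ i, G.ConnectedOn (B i)) ∧ ∀ i j, i ≠ j → ∃ x ∈ B i, ∃ y ∈ B j, G.Adj x y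

theorem ConnectedOn.singleton (G : SimpleGraph V) (v : V) : G.ConnectedOn {v} := by
  rintro x rfl y rfl
  exact .refl

/-- A vertex is one more branch set for a complete minor in its neighbourhood. -/
theorem HasCliqueMinorIn.cone {G : SimpleGraph V} {k : ℕ} (hk : 2 ≤ k) {v : V}
    (h : G.HasCliqueMinorIn k (G.neighborSet v)) : G.HasCliqueMinorIn (k + 1) Set.univ := by
  obtain ⟨B, hBS, hBd, hBc, hBa⟩ := h
  have hne : ∀ i, ∃ x ∈ B i, G.Adj v x := by
    intro i
    have : Nontrivial (Fin k) := Fin.nontrivial_iff_two_le.2 hk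
    obtain ⟨j, hj⟩ := exists_ne i
    obtain ⟨x, hx, -⟩ := hBa i j hj.symm
    exact ⟨x, hx, hBS i hx⟩
  have hv : ∀ i, v ∉ B i := fun i hi => G.loopless.irrefl v (hBS i hi)
  refine ⟨Fin.cons {v} B, fun _ => Set.subset_univ _, ?_, ?_, ?_⟩
  · intro i j
    refine Fin.cases ?_ (fun i => ?_) i <;> refine Fin.cases ?_ (fun j => ?_) j <;>
      simp only [Fin.cons_zero, Fin.cons_succ, ne_eq, not_true_eq_false, false_imp_iff,
        Fin.succ_inj, Set.disjoint_singleton_left, Set.disjoint_singleton_right]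
    · exact fun _ => hv j
    · exact fun _ => hv i
    · exact hBd i j
  · intro i
    refine Fin.cases ?_ (fun i => ?_) i
    · exact ConnectedOn.singleton G v
    · exact hBc i
  · intro i j
    refine Fin.cases ?_ (fun i => ?_) i <;> refine Fin.cases ?_ (fun j => ?_) j <;>
      simp only [Fin.cons_zero, Fin.cons_succ, ne_eq, not_true_eq_false, false_imp_iff,
        Fin.succ_inj]
    · intro _
      obtain ⟨x, hx, hvx⟩ := hne j
      exact ⟨v, rfl, x, hx, hvx⟩
    · intro _
      obtain ⟨x, hx, hvx⟩ := hne i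
      exact ⟨x, hx, v, rfl, hvx.symm⟩
    · exact hBa i j

/-! ### Minimum degree three forces a complete minor on four vertices -/

theorem connectedOn_image_Icc {G : SimpleGraph V} {f : ℕ → V} {a b : ℕ}
    (h : ∀ k, a ≤ k → k < b → G.Adj (f k) (f (k + 1))) : G.ConnectedOn (f '' Set.Icc a b) := by
  have up : ∀ x y, a ≤ x → x ≤ y → y ≤ b → Relation.ReflTransGen
      (fun p q => G.Adj p q ∧ p ∈ f '' Set.Icc a b ∧ q ∈ f '' Set.Icc a b) (f x) (f y) := by
    intro x y hax hxy
    induction y, hxy using Nat.le_induction with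
    | base => exact fun _ => .refl
    | succ y hxy ih =>
      intro hyb
      exact (ih (by omega)).tail ⟨h y (by omega) (by omega), ⟨y, ⟨by omega, by omega⟩, rfl⟩,
        ⟨y + 1, ⟨by omega, by omega⟩, rfl⟩⟩
  rintro _ ⟨x, ⟨hx, hx'⟩, rfl⟩ _ ⟨y, ⟨hy, hy'⟩, rfl⟩
  rcases le_total x y with hxy | hxy
  · exact up x y hx hxy hy'
  · have : Std.Symm (fun p q => G.Adj p q ∧ p ∈ f '' Set.Icc a b ∧ q ∈ f '' Set.Icc a b) :=
      ⟨fun p q hpq => ⟨hpq.1.symm, hpq.2.2, hpq.2.1⟩⟩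
    exact Relation.ReflTransGen.stdSymm.symm _ _ (up y x hy hxy hx')

/-- The first `m` values of `f` are the successive vertices of a path of `G` inside `S`. -/
structure IsPathIn (G : SimpleGraph V) (S : Set V) (m : ℕ) (f : ℕ → V) : Prop where
  mem : ∀ k < m, f k ∈ S
  inj : ∀ k < m, ∀ l < m, f k = f l → k = l
  adj : ∀ k, k + 1 < m → G.Adj (f k) (f (k + 1))

theorem IsPathIn.cons {G : SimpleGraph V} {S : Set V} {m : ℕ} {f : ℕ → V}
    (h : G.IsPathIn S m f) {x : V} (hx : x ∈ S) (hadj : 0 < m → G.Adj x (f 0))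
    (hne : ∀ k < m, f k ≠ x) :
    G.IsPathIn S (m + 1) (fun k => Nat.casesOn k x f) := by
  refine ⟨?_, ?_, ?_⟩
  · rintro (_ | k) hk
    · exact hx
    · exact h.mem k (by omega)
  · rintro (_ | k) hk (_ | l) hl e
    · rfl
    · exact absurd e.symm (hne l (by omega))
    · exact absurd e (hne k (by omega))
    · rw [h.inj k (by omega) l (by omega) e]
  · rintro (_ | k) hk
    · exact hadj (by omega)
    · exact h.adj k (by omega)

/-- If the first vertex of a path is adjacent to vertex number `i`, then reversing the segment
before `i` gives a path again. -/
theorem IsPathIn.rotate {G : SimpleGraph V} {S : Set V} {m : ℕ} {f : ℕ → V}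
    (h : G.IsPathIn S m f) {i : ℕ} (him : i < m) (hadj : G.Adj (f 0) (f i)) :
    G.IsPathIn S m (fun k => if k < i then f (i - 1 - k) else f k) := by
  refine ⟨?_, ?_, ?_⟩
  · intro k hk
    split_ifs
    · exact h.mem _ (by omega)
    · exact h.mem _ hk
  · intro k hk l hl e
    split_ifs at e <;> have := h.inj _ (by omega) _ (by omega) e <;> omega
  · intro k hk
    split_ifs with h1 h2
    · have := h.adj (i - 1 - (k + 1)) (by omega)
      rw [show i - 1 - (k + 1) + 1 = i - 1 - k by omega] at this
      exact this.symm
    · rw [show i - 1 - k = 0 by omega, show k + 1 = i by omega]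
      exact hadj
    · omega
    · exact h.adj k hk

/-- If all vertices of `S` have at least three neighbours in `S`, then there is a complete minor on
four vertices inside `S`.

Among the longest paths in `S`, take one whose first vertex `f 0` has its last neighbour on the
path, `f j`, as early as possible. Let `f i` be a third neighbour, `1 < i < j`. Reversing the
segment before `f i` gives another longest path, with first vertex `f (i - 1)`, which therefore has
a neighbour at `f j` or later. The four segments that start at `f 0`, `f (i - 1)`, `f i` and `f j`
are the branch sets. -/
theorem hasCliqueMinorIn_four [Finite V] {G : SimpleGraph V} {S : Set V} (hS : S.Nonempty)
    (hdeg : ∀ x ∈ S, ∀ a b : V, ∃ y ∈ S, G.Adj x y ∧ y ≠ a ∧ y ≠ b) :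
    G.HasCliqueMinorIn 4 S := by
  classical
  have hbd : ∀ m f, G.IsPathIn S m f → m ≤ Nat.card V := by
    intro m f hf
    have : Function.Injective (fun k : Fin m => f k) :=
      fun k l e => Fin.ext (hf.inj k k.2 l l.2 e)
    simpa using Nat.card_le_card_of_injective _ this
  obtain ⟨x₀, hx₀⟩ := hS
  let P : ℕ → Prop := fun m => ∃ f, G.IsPathIn S m f
  have hP1 : P 1 := ⟨fun _ => x₀, fun _ _ => hx₀, fun _ _ _ _ _ => by omega,
    fun _ _ => by omega⟩
  have hcard : 1 ≤ Nat.card V := hbd 1 _ hP1.choose_spec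
  let m := Nat.findGreatest P (Nat.card V)
  have hPm : P m := Nat.findGreatest_spec hcard hP1
  have hm1 : 1 ≤ m := Nat.le_findGreatest hcard hP1
  have hmax : ∀ f, ¬ G.IsPathIn S (m + 1) f := by
    intro f hf
    have : m + 1 ≤ m := Nat.le_findGreatest (hbd _ _ hf) ⟨f, hf⟩
    omega
  -- all neighbours of the first vertex of a longest path lie on the path
  have hon : ∀ f, G.IsPathIn S m f → ∀ y ∈ S, G.Adj (f 0) y → ∃ k < m, f k = y := by
    intro f hf y hy hadj
    by_contra! hcon
    exact hmax _ (hf.cons hy (fun _ => hadj.symm) hcon)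
  let Q : ℕ → Prop := fun j => ∃ f, G.IsPathIn S m f ∧ ∀ k < m, G.Adj (f 0) (f k) → k ≤ j
  have hQ : ∃ j, Q j := by
    obtain ⟨f, hf⟩ := hPm
    exact ⟨m, f, hf, fun k hk _ => hk.le⟩
  obtain ⟨f, hf, hfj⟩ := Nat.find_spec hQ
  have hmin : ∀ j, j < Nat.find hQ → ¬ Q j := fun j => Nat.find_min hQ
  generalize Nat.find hQ = j at hfj hmin
  -- a third neighbour
  obtain ⟨y, hyS, hy, hy1, hyj⟩ := hdeg (f 0) (hf.mem 0 hm1) (f 1) (f j)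
  obtain ⟨i, him, rfl⟩ := hon f hf y hyS hy
  have hij : i < j := lt_of_le_of_ne (hfj i him hy) (by rintro rfl; exact hyj rfl)
  have hi0 : i ≠ 0 := by rintro rfl; exact G.loopless.irrefl _ hy
  have hi1 : i ≠ 1 := by rintro rfl; exact hy1 rfl
  have hlast : ∀ g, G.IsPathIn S m g → ∃ k < m, j ≤ k ∧ G.Adj (g 0) (g k) := by
    intro g hg
    by_contra! hcon
    refine hmin (j - 1) (by omega) ⟨g, hg, fun k hk hadj => ?_⟩
    by_contra hlt
    exact hcon k hk (by omega) hadj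
  obtain ⟨l, hlm, hjl, hl⟩ := hlast f hf
  obtain ⟨k, hkm, hjk, hk⟩ := hlast _ (hf.rotate him hy)
  simp only [show 0 < i by omega, if_true, show ¬ k < i by omega, if_false, Nat.sub_zero] at hk
  let lo : Fin 4 → ℕ := ![0, i - 1, i, j]
  let hi : Fin 4 → ℕ := ![i - 2, i - 1, j - 1, m - 1]
  have him' : ∀ s, hi s < m := by
    intro s; fin_cases s <;> simp [hi] <;> omega
  have hsep : ∀ s t : Fin 4, s < t → hi s < lo t := by
    intro s t hst
    fin_cases s <;> fin_cases t <;> simp [hi, lo] at hst ⊢ <;> omega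
  have hdis : ∀ s t, s < t → Disjoint (f '' Set.Icc (lo s) (hi s)) (f '' Set.Icc (lo t) (hi t)) := by
    intro s t hst
    rw [Set.disjoint_left]
    rintro _ ⟨p, ⟨hp, hp'⟩, rfl⟩ ⟨q, ⟨hq, hq'⟩, e⟩
    have h1 := him' s
    have h2 := him' t
    have h3 := hsep s t hst
    have := hf.inj q (by omega) p (by omega) e
    omega
  have hadj : ∀ s t, s < t → ∃ x ∈ f '' Set.Icc (lo s) (hi s), ∃ y ∈ f '' Set.Icc (lo t) (hi t),
      G.Adj x y := by
    have mk : ∀ s t : Fin 4, ∀ p q : ℕ, lo s ≤ p → p ≤ hi s → lo t ≤ q → q ≤ hi t →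
        G.Adj (f p) (f q) → ∃ x ∈ f '' Set.Icc (lo s) (hi s), ∃ y ∈ f '' Set.Icc (lo t) (hi t),
          G.Adj x y :=
      fun s t p q h1 h2 h3 h4 h => ⟨f p, ⟨p, ⟨h1, h2⟩, rfl⟩, f q, ⟨q, ⟨h3, h4⟩, rfl⟩, h⟩
    have c01 := hf.adj (i - 2) (by omega)
    have c12 := hf.adj (i - 1) (by omega)
    have c23 := hf.adj (j - 1) (by omega)
    intro s t hst
    fin_cases s <;> fin_cases t <;> simp at hst
    · exact mk 0 1 _ _ (by simp [lo]) (by simp [hi]) (by simp [lo]; omega) (by simp [hi]; omega) c01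
    · exact mk 0 2 _ _ (by simp [lo]) (by simp [hi]) (by simp [lo]) (by simp [hi]; omega) hy
    · exact mk 0 3 _ _ (by simp [lo]) (by simp [hi]) (by simpa [lo]) (by simp [hi]; omega) hl
    · exact mk 1 2 _ _ (by simp [lo]) (by simp [hi]) (by simp [lo]; omega) (by simp [hi]; omega) c12
    · exact mk 1 3 _ _ (by simp [lo]) (by simp [hi]) (by simpa [lo]) (by simp [hi]; omega) hk
    · exact mk 2 3 _ _ (by simp [lo]; omega) (by simp [hi]) (by simp [lo]; omega)
        (by simp [hi]; omega) c23
  refine ⟨fun s => f '' Set.Icc (lo s) (hi s), ?_, ?_, ?_, ?_⟩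
  · rintro s _ ⟨p, ⟨hp, hp'⟩, rfl⟩
    exact hf.mem p (hp'.trans_lt (him' s))
  · intro s t hst
    rcases lt_or_gt_of_ne hst with h | h
    · exact hdis s t h
    · exact (hdis t s h).symm
  · intro s
    refine connectedOn_image_Icc fun p _ hp => hf.adj p ?_
    have := him' s
    omega
  · intro s t hst
    rcases lt_or_gt_of_ne hst with h | h
    · exact hadj s t h
    · obtain ⟨x, hx, y, hy, hxy⟩ := hadj t s h
      exact ⟨y, hy, x, hx, hxy.symm⟩

end SimpleGraph

/-! ### Contraction of an edge -/

namespace SimpleGraph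

variable {V : Type*}

open Classical in
/-- The contraction of `u` into `v`. The vertex type stays the same: `v` receives the neighbours of
`u`, and `u` becomes an isolated vertex. -/
def contractInto (G : SimpleGraph V) (u v : V) : SimpleGraph V where
  Adj x y := x ≠ y ∧ ∃ a b, G.Adj a b ∧ Function.update id u v a = x ∧ Function.update id u v b = y
  symm := ⟨fun _ _ ⟨h, a, b, hab, ha, hb⟩ => ⟨h.symm, b, a, hab.symm, hb, ha⟩⟩
  loopless := ⟨fun _ h => h.1 rfl⟩

theorem HasCliqueMinorIn.of_contractInto {G : SimpleGraph V} {u v : V} (huv : G.Adj u v) {k : ℕ}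
    (h : (G.contractInto u v).HasCliqueMinorIn k Set.univ) : G.HasCliqueMinorIn k Set.univ := by
  classical
  obtain ⟨B, -, hBd, hBc, hBa⟩ := h
  let π : V → V := Function.update id u v
  have hπu : π u = v := by simp [π]
  have hπ : ∀ x, x ≠ u → π x = x := fun x hx => by simp [π, hx]
  refine ⟨fun i => π ⁻¹' B i, fun _ => Set.subset_univ _, fun i j hij => (hBd i j hij).preimage π,
    fun i => ?_, fun i j hij => ?_⟩
  · have fib : ∀ x y, π x = π y → π x ∈ B i → Relation.ReflTransGen
        (fun a b => G.Adj a b ∧ a ∈ π ⁻¹' B i ∧ b ∈ π ⁻¹' B i) x y := by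
      intro x y e hx
      by_cases hxy : x = y
      · rw [hxy]
      refine .single ⟨?_, hx, by rwa [Set.mem_preimage, ← e]⟩
      by_cases hxu : x = u
      · subst hxu
        rw [hπu, hπ y (Ne.symm hxy)] at e
        rwa [← e]
      · by_cases hyu : y = u
        · subst hyu
          rw [hπu, hπ x hxu] at e
          rw [e]
          exact huv.symm
        · rw [hπ x hxu, hπ y hyu] at e
          exact absurd e hxy
    intro x hx y hy
    have main : ∀ z, Relation.ReflTransGen
        (fun a b => (G.contractInto u v).Adj a b ∧ a ∈ B i ∧ b ∈ B i) (π x) z →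
        ∀ y, π y = z → Relation.ReflTransGen
          (fun a b => G.Adj a b ∧ a ∈ π ⁻¹' B i ∧ b ∈ π ⁻¹' B i) x y := by
      intro z hz
      induction hz with
      | refl => exact fun y e => fib x y e.symm hx
      | tail _ hst ih =>
        obtain ⟨⟨-, a, b, hab, ha, hb⟩, hs, ht⟩ := hst
        change π a = _ at ha
        change π b = _ at hb
        intro y hy
        refine ((ih a ha).tail ⟨hab, ?_, ?_⟩).trans (fib b y (hb.trans hy.symm) ?_)
        · rwa [Set.mem_preimage, ha]
        · rwa [Set.mem_preimage, hb]
        · rwa [hb]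
    exact main _ (hBc i _ hx _ hy) y rfl
  · obtain ⟨x, hx, y, hy, -, a, b, hab, ha, hb⟩ := hBa i j hij
    change π a = _ at ha
    change π b = _ at hb
    exact ⟨a, by rwa [Set.mem_preimage, ha], b, by rwa [Set.mem_preimage, hb], hab⟩

/-- If `u` and `v` have no common neighbours but `a` and `b`, then contracting `u` into `v` destroys
at most the triangles `u v a`, `u v b` and `u a b`. -/
theorem ncard_cliqueSet_le_contractInto [Finite V] {G : SimpleGraph V} {u v a b : V}
    (huv : u ≠ v) (hab : ∀ y, G.Adj v y → G.Adj u y → y = a ∨ y = b) :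
    (G.cliqueSet 3).ncard ≤ ((G.contractInto u v).cliqueSet 3).ncard + 3 := by
  classical
  let X : Set (Finset V) := {{u, v, a}, {u, v, b}, {u, a, b}}
  have hX : X.ncard ≤ 3 := by
    refine (Set.ncard_insert_le _ _).trans ?_
    have := Set.ncard_insert_le ({u, v, b} : Finset V) {{u, a, b}}
    rw [Set.ncard_singleton] at this
    omega
  have hnot : ∀ t ∈ G.cliqueSet 3 \ X, u ∈ t → v ∉ t := by
    rintro t ⟨ht, htX⟩ hu hv
    rw [mem_cliqueSet_iff, isNClique_iff] at ht
    obtain ⟨hc, h3⟩ := ht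
    have hcard : ((t.erase u).erase v).card = 1 := by
      rw [Finset.card_erase_of_mem (Finset.mem_erase.2 ⟨huv.symm, hv⟩),
        Finset.card_erase_of_mem hu, h3]
    obtain ⟨z, hz⟩ := Finset.card_eq_one.1 hcard
    have hzm : z ∈ (t.erase u).erase v := by rw [hz]; simp
    simp only [Finset.mem_erase] at hzm
    have ht' : t = {u, v, z} := by
      rw [← Finset.insert_erase hu, ← Finset.insert_erase (Finset.mem_erase.2 ⟨huv.symm, hv⟩), hz]
    have := hab z (hc hv hzm.2.2 hzm.1.symm) (hc hu hzm.2.2 hzm.2.1.symm)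
    rcases this with rfl | rfl <;> exact htX (by simp [X, ht'])
  let φ : Finset V → Finset V := fun t => if u ∈ t then insert v (t.erase u) else t
  have hmaps : ∀ t ∈ G.cliqueSet 3 \ X, φ t ∈ (G.contractInto u v).cliqueSet 3 := by
    intro t ht
    have hn := hnot t ht
    have ht := ht.1
    rw [mem_cliqueSet_iff, isNClique_iff] at ht ⊢
    obtain ⟨hc, h3⟩ := ht
    have hbase : ∀ x ∈ t, ∀ y ∈ t, x ≠ y → x ≠ u → y ≠ u → (G.contractInto u v).Adj x y :=
      fun x hx y hy hxy hxu hyu => ⟨hxy, x, y, hc hx hy hxy, by simp [hxu], by simp [hyu]⟩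
    by_cases hu : u ∈ t
    · simp only [φ, hu, if_true]
      refine ⟨?_, ?_⟩
      · have hv : ∀ y ∈ t, y ≠ u → (G.contractInto u v).Adj v y := fun y hy hyu =>
          ⟨by rintro rfl; exact hn hu hy, u, y, hc hu hy hyu.symm, by simp, by simp [hyu]⟩
        intro x hx y hy hxy
        simp only [Finset.coe_insert, Finset.coe_erase, Set.mem_insert_iff, Set.mem_sdiff,
          Finset.mem_coe, Set.mem_singleton_iff] at hx hy
        rcases hx with rfl | ⟨hx, hxu⟩ <;> rcases hy with rfl | ⟨hy, hyu⟩
        · exact absurd rfl hxy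
        · exact hv y hy hyu
        · exact (hv x hx hxu).symm
        · exact hbase x hx y hy hxy hxu hyu
      · rw [Finset.card_insert_of_notMem (fun h => hn hu (Finset.mem_of_mem_erase h)),
          Finset.card_erase_of_mem hu, h3]
    · simp only [φ, hu, if_false]
      refine ⟨fun x hx y hy hxy => hbase x hx y hy hxy ?_ ?_, h3⟩
      · rintro rfl; exact hu hx
      · rintro rfl; exact hu hy
  have hmix : ∀ s ∈ G.cliqueSet 3 \ X, ∀ t ∈ G.cliqueSet 3, u ∈ s →
      insert v (s.erase u) ≠ t := by
    rintro s ⟨hs, hsX⟩ t ht hu rfl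
    have hsub : s ⊆ {u, a, b} := by
      intro z hz
      by_cases hzu : z = u
      · simp [hzu]
      have hvs := hnot s ⟨hs, hsX⟩ hu
      rw [mem_cliqueSet_iff, isNClique_iff] at hs ht
      have h1 := hs.1 hu hz (Ne.symm hzu)
      have h2 := ht.1 (x := v) (by simp) (y := z) (by simp [hz, hzu])
        (by rintro rfl; exact hvs hz)
      have := hab z h2 h1
      simp only [Finset.mem_insert, Finset.mem_singleton]
      exact .inr this
    refine hsX (.inr (.inr (Finset.eq_of_subset_of_card_le hsub ?_)))
    rw [(mem_cliqueSet_iff.1 hs).card_eq]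
    exact Finset.card_le_three
  have hinj : Set.InjOn φ (G.cliqueSet 3 \ X) := by
    intro s hs t ht e
    by_cases hus : u ∈ s <;> by_cases hut : u ∈ t <;> simp only [φ, hus, hut, if_true, if_false] at e
    · have h1 : v ∉ s.erase u := fun h => hnot s hs hus (Finset.mem_of_mem_erase h)
      have h2 : v ∉ t.erase u := fun h => hnot t ht hut (Finset.mem_of_mem_erase h)
      rw [← Finset.insert_erase hus, ← Finset.insert_erase hut, ← Finset.erase_insert h1, e,
        Finset.erase_insert h2]
    · exact absurd e (hmix s hs t ht.1 hus)
    · exact absurd e.symm (hmix t ht s hs.1 hut)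
    · exact e
  have h1 := Set.ncard_le_ncard_of_injOn φ hmaps hinj (Set.toFinite _)
  have h2 := Set.ncard_le_ncard_sdiff_add_ncard (G.cliqueSet 3) X (Set.toFinite _)
  omega

/-! ### Triangles in graphs without a complete minor on five vertices -/

theorem ncard_cliqueSet_le_of_support [Finite V] (k : ℕ) :
    ∀ (G : SimpleGraph V) (S : Finset V), S.card = k + 3 → (∀ x y, G.Adj x y → x ∈ S) →
      ¬ G.HasCliqueMinorIn 5 Set.univ → (G.cliqueSet 3).ncard ≤ 3 * k + 1 := by
  classical
  induction k with
  | zero =>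
    intro G S hS hGS _
    refine (Set.ncard_le_ncard (t := {S}) ?_).trans (by simp)
    intro t ht
    obtain ⟨x, y, z, hxy, hxz, hyz, rfl⟩ := is3Clique_iff.1 (mem_cliqueSet_iff.1 ht)
    refine Finset.eq_of_subset_of_card_le ?_ ?_
    · intro w hw
      simp only [Finset.mem_insert, Finset.mem_singleton] at hw
      rcases hw with rfl | rfl | rfl
      · exact hGS _ _ hxy
      · exact hGS _ _ hyz
      · exact hGS _ _ hyz.symm
    · rw [(mem_cliqueSet_iff.1 ht).card_eq, hS]
  | succ k ih =>
    intro G S hS hGS hG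
    by_cases hne : ∃ v w, G.Adj v w
    · obtain ⟨v, w, hvw⟩ := hne
      -- the neighbourhood of `v` has no complete minor on four vertices
      have hN : ¬ G.HasCliqueMinorIn 4 (G.neighborSet v) := fun h => hG (h.cone (by norm_num))
      have : ∃ u ∈ G.neighborSet v, ∃ a b, ∀ y, G.Adj v y → G.Adj u y → y = a ∨ y = b := by
        by_contra! hcon
        exact hN (hasCliqueMinorIn_four ⟨w, hvw⟩ hcon)
      obtain ⟨u, huv, a, b, hab⟩ := this
      have huv : G.Adj v u := huv
      have h1 := ncard_cliqueSet_le_contractInto huv.ne' hab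
      have h2 := ih (G.contractInto u v) (S.erase u)
        (by rw [Finset.card_erase_of_mem (hGS _ _ huv.symm), hS]; rfl)
        (by
          rintro _ _ ⟨-, p, q, hpq, rfl, rfl⟩
          by_cases hp : p = u
          · subst hp
            simpa using ⟨huv.ne, hGS _ _ huv⟩
          · simpa [hp] using hGS _ _ hpq)
        (fun h => hG (h.of_contractInto huv.symm))
      omega
    · have : G.cliqueSet 3 = ∅ := by
        refine Set.eq_empty_of_forall_notMem fun t ht => hne ?_
        obtain ⟨x, y, z, hxy, -⟩ := is3Clique_iff.1 (mem_cliqueSet_iff.1 ht)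
        exact ⟨x, y, hxy⟩
      simp [this]

end SimpleGraph

/-! ### Planar graphs have no complete minor on five vertices -/

namespace PlaneDrawing

variable {V : Type*} {G : SimpleGraph V}

/-- The part of the drawing that represents the subgraph induced by `U`. -/
def inducedSupport (D : PlaneDrawing G) (U : Set V) : Set Plane :=
  D.pt '' U ∪ ⋃ (e : G.edgeSet) (_ : ∀ w ∈ (e : Sym2 V), w ∈ U), D.arc e

theorem inducedSupport_mono (D : PlaneDrawing G) {U W : Set V} (h : U ⊆ W) :
    D.inducedSupport U ⊆ D.inducedSupport W := by
  refine Set.union_subset_union (Set.image_mono h) ?_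
  exact Set.iUnion_mono fun e => Set.iUnion_mono' fun he => ⟨fun w hw => h (he w hw), subset_rfl⟩

theorem disjoint_inducedSupport (D : PlaneDrawing G) {U W : Set V} (h : Disjoint U W) :
    Disjoint (D.inducedSupport U) (D.inducedSupport W) := by
  rw [Set.disjoint_left] at h ⊢
  intro p hp hq
  simp only [inducedSupport, Set.mem_union, Set.mem_image, Set.mem_iUnion] at hp hq
  rcases hp with ⟨u, hu, rfl⟩ | ⟨e, he, hpe⟩ <;> rcases hq with ⟨w, hw, hpw⟩ | ⟨f, hf, hpf⟩
  · exact h hu (D.pt_injective hpw ▸ hw)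
  · exact h hu (hf u (D.mem_of_pt_mem_arc f u hpf))
  · subst hpw
    exact h (he w (D.mem_of_pt_mem_arc e w hpe)) hw
  · by_cases hef : e = f
    · subst hef
      obtain ⟨w, hw⟩ := (e : Sym2 V).ind (f := fun s => ∃ w, w ∈ s) (fun a b => ⟨a, by simp⟩)
      exact h (he w hw) (hf w hw)
    · obtain ⟨w, rfl⟩ := D.arc_inter_arc e f hef ⟨hpe, hpf⟩
      exact h (he w (D.mem_of_pt_mem_arc e w hpe)) (hf w (D.mem_of_pt_mem_arc f w hpf))

theorem joinedIn_of_adj (D : PlaneDrawing G) {U : Set V} {x y : V} (hxy : G.Adj x y) (hx : x ∈ U)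
    (hy : y ∈ U) : JoinedIn (D.inducedSupport U) (D.pt x) (D.pt y) := by
  obtain ⟨γ, -, hγ⟩ := D.arc_isArc x y hxy
  refine ⟨γ, fun t => .inr ?_⟩
  simp only [Set.mem_iUnion]
  refine ⟨⟨s(x, y), hxy⟩, ?_, hγ ▸ Set.mem_range_self t⟩
  intro w hw
  rcases Sym2.mem_iff.1 hw with rfl | rfl <;> assumption

theorem joinedIn_of_connectedOn (D : PlaneDrawing G) {U : Set V} (hU : G.ConnectedOn U) {x y : V}
    (hx : x ∈ U) (hy : y ∈ U) : JoinedIn (D.inducedSupport U) (D.pt x) (D.pt y) := by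
  have := hU x hx y hy
  clear hy
  induction this with
  | refl => exact JoinedIn.refl (.inl ⟨x, hx, rfl⟩)
  | tail _ h ih => exact ih.trans (D.joinedIn_of_adj h.1 h.2.1 h.2.2)

/-- From a complete minor on five vertices, choose a root in each branch set and join any two
roots inside the drawing of the union of their branch sets. Paths that belong to disjoint pairs of
branch sets do not meet, which contradicts `no_almost_embedding_K5`. -/
theorem not_hasCliqueMinorIn_five (D : PlaneDrawing G) : ¬ G.HasCliqueMinorIn 5 Set.univ := by
  rintro ⟨B, -, hBd, hBc, hBa⟩
  have hne : ∀ i, ∃ x, x ∈ B i := by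
    intro i
    obtain ⟨j, hj⟩ := exists_ne i
    obtain ⟨x, hx, -⟩ := hBa i j hj.symm
    exact ⟨x, hx⟩
  choose r hr using hne
  have hJ : ∀ i j, ∃ γ : ℝ → Plane, i ≠ j → Continuous γ ∧ γ 0 = D.pt (r i) ∧ γ 1 = D.pt (r j) ∧
      ∀ t, γ t ∈ D.inducedSupport (B i ∪ B j) := by
    intro i j
    by_cases hij : i = j
    · exact ⟨fun _ => 0, fun h => absurd hij h⟩
    obtain ⟨x, hx, y, hy, hxy⟩ := hBa i j hij
    have h1 := (D.joinedIn_of_connectedOn (hBc i) (hr i) hx).mono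
      (D.inducedSupport_mono (Set.subset_union_left (t := B j)))
    have h2 := D.joinedIn_of_adj (U := B i ∪ B j) hxy (.inl hx) (.inr hy)
    have h3 := (D.joinedIn_of_connectedOn (hBc j) hy (hr j)).mono
      (D.inducedSupport_mono (Set.subset_union_right (s := B i)))
    obtain ⟨γ, hγ⟩ := (h1.trans h2).trans h3
    exact ⟨γ.extend, fun _ => ⟨γ.continuous_extend, γ.extend_zero, γ.extend_one, fun t => hγ _⟩⟩
  choose γ hγ using hJ
  let φ : Plane → ℂ := fun p => ⟨p 0, p 1⟩
  have hφ : Continuous φ := by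
    have : φ = fun p => ((p 0 : ℝ) : ℂ) + ((p 1 : ℝ) : ℂ) * Complex.I := by
      funext p
      exact Complex.mk_eq_add_mul_I _ _
    rw [this]
    fun_prop
  have hφi : Function.Injective φ := by
    intro p q h
    ext i
    fin_cases i
    · exact congrArg Complex.re h
    · exact congrArg Complex.im h
  refine no_almost_embedding_K5 (fun i => φ (D.pt (r i))) (fun i j t => φ (γ i j t))
    (fun i j h => hφ.comp (hγ i j h).1) (fun i j h => by rw [(hγ i j h).2.1])
    (fun i j h => by rw [(hγ i j h).2.2.1]) ?_
  intro i j k l h s t e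
  simp only [List.nodup_cons, List.mem_cons, List.not_mem_nil, or_false, not_or] at h
  obtain ⟨⟨hij, hik, hil⟩, ⟨hjk, hjl⟩, hkl, -⟩ := h
  have hdis : Disjoint (B i ∪ B j) (B k ∪ B l) :=
    Set.disjoint_union_left.2 ⟨Set.disjoint_union_right.2 ⟨hBd _ _ hik, hBd _ _ hil⟩,
      Set.disjoint_union_right.2 ⟨hBd _ _ hjk, hBd _ _ hjl⟩⟩
  have := hφi e
  exact Set.disjoint_left.1 (D.disjoint_inducedSupport hdis) ((hγ i j hij).2.2.2 s)
    (this ▸ (hγ k l hkl).2.2.2 t)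

end PlaneDrawing

theorem IsPlanarGraph.numThreeCliques_le {V : Type*} [Finite V] {G : SimpleGraph V}
    (hG : IsPlanarGraph G) (hV : 3 ≤ Nat.card V) : numThreeCliques G ≤ 3 * Nat.card V - 8 := by
  classical
  obtain ⟨D⟩ := hG
  cases nonempty_fintype V
  rw [Nat.card_eq_fintype_card] at hV ⊢
  have := SimpleGraph.ncard_cliqueSet_le_of_support (Fintype.card V - 3) G Finset.univ
    (by rw [Finset.card_univ]; omega) (fun _ _ _ => Finset.mem_univ _) D.not_hasCliqueMinorIn_five
  unfold numThreeCliques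
  omega

/-! ### Triangles in the plane -/

/-- The affine function `p ↦ a + b * p 0 + c * p 1` on the plane. -/
def Plane.affineForm (a b c : ℝ) : Plane →ᵃ[ℝ] ℝ where
  toFun p := a + b * p 0 + c * p 1
  linear :=
    { toFun := fun p => b * p 0 + c * p 1
      map_add' := fun p q => by simp only [PiLp.add_apply]; ring
      map_smul' := fun s p => by simp only [PiLp.smul_apply, smul_eq_mul, RingHom.id_apply]; ring }
  map_vadd' p v := by
    simp only [vadd_eq_add, PiLp.add_apply, LinearMap.coe_mk, AddHom.coe_mk]
    ring

@[simp]
theorem Plane.affineForm_apply (a b c : ℝ) (p : Plane) :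
    Plane.affineForm a b c p = a + b * p 0 + c * p 1 := rfl

/-- The functions `f i` are the barycentric coordinates with respect to the triangle with
vertices `P i`. -/
structure IsBarycentric (P : Fin 3 → Plane) (f : Fin 3 → Plane →ᵃ[ℝ] ℝ) : Prop where
  apply_vertex : ∀ i j, f i (P j) = if i = j then 1 else 0
  sum_eq_one : ∀ p, f 0 p + f 1 p + f 2 p = 1
  sum_smul : ∀ p, f 0 p • P 0 + f 1 p • P 1 + f 2 p • P 2 = p

namespace IsBarycentric

variable {P : Fin 3 → Plane} {f : Fin 3 → Plane →ᵃ[ℝ] ℝ}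

theorem exists_center (h : IsBarycentric P f) : ∃ c, ∀ i, f i c = 1 / 3 := by
  refine ⟨AffineMap.lineMap (AffineMap.lineMap (P 0) (P 1) (1 / 2 : ℝ)) (P 2) (1 / 3 : ℝ), ?_⟩
  intro i
  rw [AffineMap.apply_lineMap, AffineMap.apply_lineMap, h.apply_vertex, h.apply_vertex,
    h.apply_vertex]
  fin_cases i <;> simp [AffineMap.lineMap_apply] <;> norm_num

theorem continuous_coord (i : Fin 3) : Continuous (f i) :=
  (f i).continuous_of_finiteDimensional

theorem isOpen_pos : IsOpen {p | ∀ i, 0 < f i p} := by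
  simp only [Set.ofPred_forall]
  exact isOpen_iInter_of_finite fun i => isOpen_lt continuous_const (continuous_coord i)

theorem isClosed_nonneg : IsClosed {p | ∀ i, 0 ≤ f i p} := by
  simp only [Set.ofPred_forall]
  exact isClosed_iInter fun i => isClosed_le continuous_const (continuous_coord i)

theorem isPreconnected_pos : IsPreconnected {p | ∀ i, 0 < f i p} := by
  have : {p | ∀ i, 0 < f i p} = ⋂ i, f i ⁻¹' Set.Ioi 0 := by ext; simp
  rw [this]
  exact (convex_iInter fun i => (convex_Ioi (0 : ℝ)).affine_preimage (f i)).isPreconnected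

theorem closure_pos (h : IsBarycentric P f) :
    closure {p | ∀ i, 0 < f i p} = {p | ∀ i, 0 ≤ f i p} := by
  refine (closure_minimal (fun p hp i => (hp i).le) isClosed_nonneg).antisymm fun p hp => ?_
  obtain ⟨c, hc⟩ := h.exists_center
  have hlim : Filter.Tendsto (fun t : ℝ => AffineMap.lineMap p c t) (nhdsWithin 0 (Set.Ioo 0 1))
      (nhds p) := by
    have : Continuous (fun t : ℝ => AffineMap.lineMap p c t) := by
      simp only [AffineMap.lineMap_apply]; fun_prop
    simpa using (this.tendsto 0).mono_left nhdsWithin_le_nhds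
  have : (nhdsWithin (0 : ℝ) (Set.Ioo 0 1)).NeBot := by
    rw [← mem_closure_iff_nhdsWithin_neBot, closure_Ioo (by norm_num)]
    simp
  refine mem_closure_of_tendsto hlim (Filter.mem_of_superset self_mem_nhdsWithin ?_)
  intro t ht i
  rw [AffineMap.apply_lineMap, hc, AffineMap.lineMap_apply]
  have := hp i
  simp only [vsub_eq_sub, vadd_eq_add, smul_eq_mul]
  nlinarith [ht.1, ht.2, mul_nonneg this (sub_nonneg.2 ht.2.le)]

theorem interior_nonneg (h : IsBarycentric P f) :
    interior {p | ∀ i, 0 ≤ f i p} = {p | ∀ i, 0 < f i p} := by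
  refine Set.Subset.antisymm (fun p hp i => ?_)
    (interior_maximal (fun p hp i => (hp i).le) isOpen_pos)
  obtain ⟨c, hc⟩ := h.exists_center
  -- moving away from the centre decreases a coordinate that vanishes
  have hlim : Filter.Tendsto (fun t : ℝ => AffineMap.lineMap p c t) (nhdsWithin 0 (Set.Iio 0))
      (nhds p) := by
    have : Continuous (fun t : ℝ => AffineMap.lineMap p c t) := by
      simp only [AffineMap.lineMap_apply]; fun_prop
    simpa using (this.tendsto 0).mono_left nhdsWithin_le_nhds
  obtain ⟨t, ht, ht0⟩ := ((hlim.eventually (mem_interior_iff_mem_nhds.1 hp)).and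
    self_mem_nhdsWithin).exists
  have hp0 : 0 ≤ f i p := interior_subset hp i
  refine lt_of_le_of_ne hp0 fun e => ?_
  have h1 : 0 ≤ f i (AffineMap.lineMap p c t) := ht i
  rw [AffineMap.apply_lineMap, hc, AffineMap.lineMap_apply, ← e] at h1
  simp only [vsub_eq_sub, vadd_eq_add, smul_eq_mul] at h1
  have : t < 0 := ht0
  linarith

theorem nonneg_diff_pos (h : IsBarycentric P f) :
    {p | ∀ i, 0 ≤ f i p} \ {p | ∀ i, 0 < f i p} =
      segment ℝ (P 0) (P 1) ∪ segment ℝ (P 1) (P 2) ∪ segment ℝ (P 2) (P 0) := by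
  have hseg : ∀ i j k, k ≠ i → k ≠ j → segment ℝ (P i) (P j) ⊆
      {p | ∀ i, 0 ≤ f i p} \ {p | ∀ i, 0 < f i p} := by
    intro i j k hki hkj p hp
    rw [segment_eq_image_lineMap] at hp
    obtain ⟨t, ht, rfl⟩ := hp
    have hval : ∀ l, f l (AffineMap.lineMap (P i) (P j) t) =
        (1 - t) * (if l = i then 1 else 0) + t * (if l = j then 1 else 0) := by
      intro l
      rw [AffineMap.apply_lineMap, h.apply_vertex, h.apply_vertex, AffineMap.lineMap_apply]
      simp only [vsub_eq_sub, vadd_eq_add, smul_eq_mul]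
      ring
    refine ⟨fun l => ?_, fun hpos => ?_⟩
    · rw [hval]
      have h1 := ht.1
      have h2 : 0 ≤ 1 - t := sub_nonneg.2 ht.2
      split_ifs <;> simp <;> linarith
    · have := hpos k
      rw [hval, if_neg hki, if_neg hkj] at this
      simp at this
  refine Set.Subset.antisymm ?_ (Set.union_subset (Set.union_subset ?_ ?_) ?_)
  · rintro p ⟨hp, hp'⟩
    simp only [Set.mem_ofPred_eq, not_forall, not_lt] at hp hp'
    obtain ⟨i, hi⟩ := hp'
    have hi : f i p = 0 := le_antisymm hi (hp i)
    have h1 := h.sum_eq_one p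
    have h2 := h.sum_smul p
    fin_cases i <;> simp only [Fin.zero_eta, Fin.mk_one, Fin.reduceFinMk] at hi <;>
      rw [hi] at h1 h2
    · exact .inl (.inr ⟨f 1 p, f 2 p, hp 1, hp 2, by linarith, by simpa using h2⟩)
    · exact .inr ⟨f 2 p, f 0 p, hp 2, hp 0, by linarith, by simpa [add_comm] using h2⟩
    · exact .inl (.inl ⟨f 0 p, f 1 p, hp 0, hp 1, by linarith, by simpa using h2⟩)
  · exact hseg 0 1 2 (by decide) (by decide)
  · exact hseg 1 2 0 (by decide) (by decide)
  · exact hseg 2 0 1 (by decide) (by decide)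

theorem frontier_pos (h : IsBarycentric P f) : frontier {p | ∀ i, 0 < f i p} =
    segment ℝ (P 0) (P 1) ∪ segment ℝ (P 1) (P 2) ∪ segment ℝ (P 2) (P 0) := by
  rw [isOpen_pos.frontier_eq, h.closure_pos, h.nonneg_diff_pos]

theorem frontier_neg (h : IsBarycentric P f) : frontier {p | ∃ i, f i p < 0} =
    segment ℝ (P 0) (P 1) ∪ segment ℝ (P 1) (P 2) ∪ segment ℝ (P 2) (P 0) := by
  have : {p | ∃ i, f i p < 0} = {p | ∀ i, 0 ≤ f i p}ᶜ := by ext; simp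
  rw [this, frontier_compl, isClosed_nonneg.frontier_eq, h.interior_nonneg, h.nonneg_diff_pos]

theorem isPreconnected_neg (h : IsBarycentric P f) : IsPreconnected {p | ∃ i, f i p < 0} := by
  have hU : ∀ i, IsPreconnected {p | f i p < 0} := fun i =>
    ((convex_Iio (0 : ℝ)).affine_preimage (f i)).isPreconnected
  obtain ⟨c, hc⟩ := h.exists_center
  have hne : ∀ k, ∃ p, ∀ i, i ≠ k → f i p < 0 := by
    intro k
    refine ⟨AffineMap.lineMap c (P k) (3 : ℝ), fun i hik => ?_⟩
    rw [AffineMap.apply_lineMap, h.apply_vertex, hc, if_neg hik, AffineMap.lineMap_apply]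
    norm_num
  obtain ⟨p, hp⟩ := hne 2
  obtain ⟨q, hq⟩ := hne 0
  have : {p | ∃ i, f i p < 0} = ({p | f 0 p < 0} ∪ {p | f 1 p < 0}) ∪ {p | f 2 p < 0} := by
    ext p
    simp [Fin.exists_fin_succ, or_assoc]
  rw [this]
  exact ((hU 0).union p (hp 0 (by decide)) (hp 1 (by decide)) (hU 1)).union q
    (.inr (hq 1 (by decide))) (hq 2 (by decide)) (hU 2)

end IsBarycentric

/-- A connected set that avoids `K` and whose frontier lies in `K` is a component of the
complement of `K`. -/
theorem connectedComponentIn_compl_eq {X : Type*} [TopologicalSpace X] {K F : Set X}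
    (hF : IsPreconnected F) (hFK : F ⊆ Kᶜ) (hfr : frontier F ⊆ K) {p : X} (hp : p ∈ F) :
    connectedComponentIn Kᶜ p = F := by
  refine Set.Subset.antisymm ?_ (hF.subset_connectedComponentIn hp hFK)
  have hsub : connectedComponentIn Kᶜ p ⊆ Kᶜ := connectedComponentIn_subset _ _
  have hp' : p ∈ connectedComponentIn Kᶜ p := mem_connectedComponentIn (hFK hp)
  have hnf : ∀ q ∈ connectedComponentIn Kᶜ p, q ∉ frontier F := fun q hq h => hsub hq (hfr h)
  refine Set.Subset.trans ?_ (interior_subset (s := F))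
  refine isPreconnected_connectedComponentIn.subset_left_of_subset_union isOpen_interior
    (isClosed_closure (s := F)).isOpen_compl ?_ ?_ ⟨p, hp', ?_⟩
  · exact Set.disjoint_compl_right_iff_subset.2 (interior_subset.trans subset_closure)
  · intro q hq
    by_cases hqc : q ∈ closure F
    · left
      by_contra hqi
      exact hnf q hq ⟨hqc, hqi⟩
    · exact .inr hqc
  · by_contra hpi
    exact hnf p hp' ⟨subset_closure hp, hpi⟩

/-! ### The double fan: a path joined to an edge -/

/-- The join of an edge (the vertices `0` and `1`) and a path (the vertices from `2` on). -/
def doubleFan (n : ℕ) : SimpleGraph (Fin n) where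
  Adj u v := u ≠ v ∧ (u.val ≤ 1 ∨ v.val ≤ 1 ∨ u.val + 1 = v.val ∨ v.val + 1 = u.val)
  symm := ⟨fun _ _ ⟨h, h'⟩ => ⟨h.symm, by tauto⟩⟩
  loopless := ⟨fun _ h => h.1 rfl⟩

/-- The position of the vertex `k` of the double fan: the vertices `0` and `1` are at `(∓1, 0)`, the
vertex `k ≥ 2` is at `(0, k - 1)`. -/
noncomputable def fanPoint (k : ℕ) : Plane :=
  if k ≤ 1 then !₂[2 * (k : ℝ) - 1, 0] else !₂[0, (k : ℝ) - 1]

theorem fanPoint_x_of_le {k : ℕ} (h : k ≤ 1) : fanPoint k 0 = 2 * (k : ℝ) - 1 := by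
  simp [fanPoint, h]

theorem fanPoint_y_of_le {k : ℕ} (h : k ≤ 1) : fanPoint k 1 = 0 := by simp [fanPoint, h]

theorem fanPoint_x {k : ℕ} (h : 2 ≤ k) : fanPoint k 0 = 0 := by
  simp [fanPoint, show ¬ k ≤ 1 by omega]

theorem fanPoint_y {k : ℕ} (h : 2 ≤ k) : fanPoint k 1 = (k : ℝ) - 1 := by
  simp [fanPoint, show ¬ k ≤ 1 by omega]

theorem Plane.ext {p q : Plane} (h0 : p 0 = q 0) (h1 : p 1 = q 1) : p = q := by
  ext i
  fin_cases i
  · exact h0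
  · exact h1

theorem mem_segment_plane_iff {p q r : Plane} : r ∈ segment ℝ p q ↔
    ∃ t : ℝ, 0 ≤ t ∧ t ≤ 1 ∧ r 0 = p 0 + t * (q 0 - p 0) ∧ r 1 = p 1 + t * (q 1 - p 1) := by
  rw [segment_eq_image_lineMap]
  constructor
  · rintro ⟨t, ht, rfl⟩
    refine ⟨t, ht.1, ht.2, ?_, ?_⟩ <;> simp [AffineMap.lineMap_apply] <;> ring
  · rintro ⟨t, h0, h1, hx, hy⟩
    refine ⟨t, ⟨h0, h1⟩, Plane.ext ?_ ?_⟩ <;> simp [AffineMap.lineMap_apply, *] <;> ring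

theorem mem_base_iff {p : Plane} :
    p ∈ segment ℝ (fanPoint 0) (fanPoint 1) ↔ p 1 = 0 ∧ -1 ≤ p 0 ∧ p 0 ≤ 1 := by
  simp only [mem_segment_plane_iff, fanPoint_x_of_le zero_le_one, fanPoint_y_of_le zero_le_one,
    fanPoint_x_of_le le_rfl, fanPoint_y_of_le le_rfl, Nat.cast_zero, Nat.cast_one]
  constructor
  · rintro ⟨t, h0, h1, hx, hy⟩
    refine ⟨by linarith, by linarith, by linarith⟩
  · rintro ⟨h, h0, h1⟩
    exact ⟨(p 0 + 1) / 2, by linarith, by linarith, by ring, by rw [h]; ring⟩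

/-- The horizontal position `±1` of the vertex `h ∈ {0, 1}` has square one. -/
theorem hub_sq {h : ℕ} (hh : h ≤ 1) : (2 * (h : ℝ) - 1) * (2 * (h : ℝ) - 1) = 1 := by
  interval_cases h <;> norm_num

theorem mem_spoke_iff {h k : ℕ} (hh : h ≤ 1) (hk : 2 ≤ k) {p : Plane} :
    p ∈ segment ℝ (fanPoint h) (fanPoint k) ↔
      p 1 = ((k : ℝ) - 1) * (1 - (2 * (h : ℝ) - 1) * p 0) ∧
        0 ≤ (2 * (h : ℝ) - 1) * p 0 ∧ (2 * (h : ℝ) - 1) * p 0 ≤ 1 := by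
  have hs := hub_sq hh
  simp only [mem_segment_plane_iff, fanPoint_x_of_le hh, fanPoint_y_of_le hh, fanPoint_x hk,
    fanPoint_y hk]
  generalize 2 * (h : ℝ) - 1 = ε at *
  constructor
  · rintro ⟨t, h0, h1, hx, hy⟩
    have : ε * p 0 = 1 - t := by rw [hx]; linear_combination (1 - t) * hs
    rw [this]
    exact ⟨by rw [hy]; ring, by linarith, by linarith⟩
  · rintro ⟨hy, h0, h1⟩
    refine ⟨1 - ε * p 0, by linarith, by linarith, ?_, by rw [hy]; ring⟩
    linear_combination (-p 0) * hs

theorem mem_spine_iff {k : ℕ} (hk : 2 ≤ k) {p : Plane} :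
    p ∈ segment ℝ (fanPoint k) (fanPoint (k + 1)) ↔
      p 0 = 0 ∧ (k : ℝ) - 1 ≤ p 1 ∧ p 1 ≤ k := by
  simp only [mem_segment_plane_iff, fanPoint_x hk, fanPoint_y hk,
    fanPoint_x (show 2 ≤ k + 1 by omega), fanPoint_y (show 2 ≤ k + 1 by omega)]
  push_cast
  constructor
  · rintro ⟨t, h0, h1, hx, hy⟩
    refine ⟨by rw [hx]; ring, by linarith, by linarith⟩
  · rintro ⟨hx, h0, h1⟩
    exact ⟨p 1 - (k - 1), by linarith, by linarith, by rw [hx]; ring, by ring⟩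

/-- The pairs of numbers that are edges of the double fan, in a preferred orientation. -/
def IsFanEdge (a b : ℕ) : Prop :=
  (a = 0 ∧ b = 1) ∨ (a ≤ 1 ∧ 2 ≤ b) ∨ (2 ≤ a ∧ b = a + 1)

theorem doubleFan_adj_cases {n : ℕ} {u v : Fin n} (h : (doubleFan n).Adj u v) :
    IsFanEdge u v ∨ IsFanEdge v u := by
  obtain ⟨hne, h⟩ := h
  have : u.val ≠ v.val := fun e => hne (Fin.ext e)
  unfold IsFanEdge
  omega

theorem IsFanEdge.adj {n : ℕ} {u v : Fin n} (h : IsFanEdge u v) : (doubleFan n).Adj u v := by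
  unfold IsFanEdge at h
  refine ⟨fun e => ?_, ?_⟩
  · subst e
    omega
  · omega

theorem fanPoint_injective : Function.Injective fanPoint := by
  intro j k e
  have hx := congrArg (fun p : Plane => p 0) e
  have hy := congrArg (fun p : Plane => p 1) e
  simp only at hx hy
  rcases Nat.lt_or_ge j 2 with hj | hj <;> rcases Nat.lt_or_ge k 2 with hk | hk
  · rw [fanPoint_x_of_le (by omega), fanPoint_x_of_le (by omega)] at hx
    have : (j : ℝ) = k := by linarith
    exact_mod_cast this
  · rw [fanPoint_y_of_le (by omega), fanPoint_y hk] at hy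
    have : (k : ℝ) = 1 := by linarith
    have : k = 1 := by exact_mod_cast this
    omega
  · rw [fanPoint_y_of_le (k := k) (by omega), fanPoint_y hj] at hy
    have : (j : ℝ) = 1 := by linarith
    have : j = 1 := by exact_mod_cast this
    omega
  · rw [fanPoint_y hj, fanPoint_y hk] at hy
    have : (j : ℝ) = k := by linarith
    exact_mod_cast this

theorem eq_or_eq_of_fanPoint_mem {a b w : ℕ} (h : IsFanEdge a b)
    (hw : fanPoint w ∈ segment ℝ (fanPoint a) (fanPoint b)) : w = a ∨ w = b := by
  rcases h with ⟨rfl, rfl⟩ | ⟨ha, hb⟩ | ⟨ha, rfl⟩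
  · rw [mem_base_iff] at hw
    by_contra hcon
    have h2 : 2 ≤ w := by omega
    rw [fanPoint_y h2] at hw
    have : (2 : ℝ) ≤ w := by exact_mod_cast h2
    linarith [hw.1]
  · rw [mem_spoke_iff ha hb] at hw
    rcases Nat.lt_or_ge w 2 with h2 | h2
    · rw [fanPoint_x_of_le (by omega), fanPoint_y_of_le (by omega)] at hw
      have hb' : (2 : ℝ) ≤ b := by exact_mod_cast hb
      have h1 : 1 - (2 * (a : ℝ) - 1) * (2 * (w : ℝ) - 1) = 0 :=
        (mul_eq_zero.1 hw.1.symm).resolve_left (by linarith)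
      left
      have hw1 : w ≤ 1 := by omega
      interval_cases a <;> interval_cases w <;> first | rfl | norm_num at h1
    · rw [fanPoint_x h2, fanPoint_y h2] at hw
      right
      have : (w : ℝ) = b := by linarith [hw.1]
      exact_mod_cast this
  · rw [mem_spine_iff ha] at hw
    rcases Nat.lt_or_ge w 2 with h2 | h2
    · rw [fanPoint_y_of_le (by omega)] at hw
      have ha' : (2 : ℝ) ≤ a := by exact_mod_cast ha
      linarith [hw.2.1]
    · rw [fanPoint_y h2] at hw
      have h1 : a ≤ w := by
        have : (a : ℝ) ≤ w := by linarith [hw.2.1]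
        exact_mod_cast this
      have h2 : w ≤ a + 1 := by
        have : (w : ℝ) ≤ a + 1 := by linarith [hw.2.2]
        exact_mod_cast this
      omega

/-- Two different edges of the double fan meet only in points that represent vertices of the
first edge. -/
theorem mem_vertex_of_mem_edges {a b c d : ℕ} (h : IsFanEdge a b) (h' : IsFanEdge c d)
    (hne : ¬ (a = c ∧ b = d)) {p : Plane} (hp : p ∈ segment ℝ (fanPoint a) (fanPoint b))
    (hp' : p ∈ segment ℝ (fanPoint c) (fanPoint d)) : p = fanPoint a ∨ p = fanPoint b := by
  have base_spoke : ∀ {c d : ℕ}, c ≤ 1 → 2 ≤ d → p ∈ segment ℝ (fanPoint 0) (fanPoint 1) →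
      p ∈ segment ℝ (fanPoint c) (fanPoint d) → p = fanPoint c := by
    intro c d hc hd hp hp'
    rw [mem_base_iff] at hp
    rw [mem_spoke_iff hc hd] at hp'
    have hd' : (2 : ℝ) ≤ d := by exact_mod_cast hd
    have hs := hub_sq hc
    have h1 : 1 - (2 * (c : ℝ) - 1) * p 0 = 0 :=
      (mul_eq_zero.1 (hp'.1.symm.trans hp.1)).resolve_left (by linarith)
    refine Plane.ext ?_ ?_
    · rw [fanPoint_x_of_le hc]
      linear_combination (-p 0) * hs - (2 * (c : ℝ) - 1) * h1
    · rw [fanPoint_y_of_le hc, hp.1]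
  have base_spine : ∀ {c : ℕ}, 2 ≤ c → p ∈ segment ℝ (fanPoint 0) (fanPoint 1) →
      p ∉ segment ℝ (fanPoint c) (fanPoint (c + 1)) := by
    intro c hc hp hp'
    rw [mem_base_iff] at hp
    rw [mem_spine_iff hc] at hp'
    have hc' : (2 : ℝ) ≤ c := by exact_mod_cast hc
    linarith [hp.1, hp'.2.1]
  have spoke_top : ∀ {a b : ℕ}, a ≤ 1 → 2 ≤ b → p ∈ segment ℝ (fanPoint a) (fanPoint b) →
      p 0 = 0 → p = fanPoint b := by
    intro a b ha hb hp h0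
    rw [mem_spoke_iff ha hb] at hp
    refine Plane.ext ?_ ?_
    · rw [h0, fanPoint_x hb]
    · rw [fanPoint_y hb, hp.1, h0]; ring
  have spoke_bot : ∀ {a b : ℕ}, a ≤ 1 → 2 ≤ b → p ∈ segment ℝ (fanPoint a) (fanPoint b) →
      p 1 = 0 → p = fanPoint a := by
    intro a b ha hb hp h1
    refine base_spoke ha hb ?_ hp
    rw [mem_spoke_iff ha hb] at hp
    rw [mem_base_iff]
    refine ⟨h1, ?_⟩
    interval_cases a <;> norm_num at hp <;> constructor <;> linarith [hp.2.1, hp.2.2]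
  rcases h with ⟨rfl, rfl⟩ | ⟨ha, hb⟩ | ⟨ha, rfl⟩
  · rcases h' with ⟨rfl, rfl⟩ | ⟨hc, hd⟩ | ⟨hc, rfl⟩
    · exact absurd ⟨rfl, rfl⟩ hne
    · rw [base_spoke hc hd hp hp']
      interval_cases c <;> simp
    · exact absurd hp' (base_spine hc hp)
  · rcases h' with ⟨rfl, rfl⟩ | ⟨hc, hd⟩ | ⟨hc, rfl⟩
    · exact .inl (base_spoke ha hb hp' hp)
    · by_cases h0 : p 0 = 0
      · exact .inr (spoke_top ha hb hp h0)
      by_cases h1 : p 1 = 0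
      · exact .inl (spoke_bot ha hb hp h1)
      exfalso
      rw [mem_spoke_iff ha hb] at hp
      rw [mem_spoke_iff hc hd] at hp'
      have hac : a = c := by
        by_contra hac
        have : 2 * (c : ℝ) - 1 = -(2 * (a : ℝ) - 1) := by
          interval_cases a <;> interval_cases c <;> first | exact absurd rfl hac | norm_num
        rw [this] at hp'
        have hz : (2 * (a : ℝ) - 1) * p 0 = 0 := by linarith [hp.2.1, hp'.2.1]
        have hs := hub_sq ha
        exact h0 (by linear_combination (-p 0) * hs + (2 * (a : ℝ) - 1) * hz)
      subst hac
      have hz : ((b : ℝ) - d) * (1 - (2 * (a : ℝ) - 1) * p 0) = 0 := by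
        linear_combination hp'.1 - hp.1
      rcases mul_eq_zero.1 hz with hz | hz
      · have : (b : ℝ) = d := by linarith
        exact hne ⟨rfl, by exact_mod_cast this⟩
      · rw [hz, mul_zero] at hp
        exact h1 hp.1
    · exact .inr (spoke_top ha hb hp ((mem_spine_iff hc).1 hp').1)
  · rcases h' with ⟨rfl, rfl⟩ | ⟨hc, hd⟩ | ⟨hc, rfl⟩
    · exact absurd hp (base_spine ha hp')
    · have hpd := spoke_top hc hd hp' ((mem_spine_iff ha).1 hp).1
      rw [hpd] at hp ⊢
      rcases eq_or_eq_of_fanPoint_mem (.inr (.inr ⟨ha, rfl⟩)) hp with rfl | rfl <;> simp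
    · rw [mem_spine_iff ha] at hp
      rw [mem_spine_iff hc] at hp'
      rcases lt_or_gt_of_ne (show a ≠ c by rintro rfl; exact hne ⟨rfl, rfl⟩) with h | h
      · right
        have : (a : ℝ) + 1 ≤ c := by exact_mod_cast h
        refine Plane.ext ?_ ?_
        · rw [fanPoint_x (by omega), hp.1]
        · rw [fanPoint_y (by omega)]
          push_cast
          linarith [hp.2.2, hp'.2.1]
      · left
        have : (c : ℝ) + 1 ≤ a := by exact_mod_cast h
        refine Plane.ext ?_ ?_
        · rw [fanPoint_x (by omega), hp.1]
        · rw [fanPoint_y (by omega)]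
          linarith [hp.2.1, hp'.2.2]

/-- The segment in the plane that represents an edge of the double fan. -/
noncomputable def fanSegment {n : ℕ} (e : Sym2 (Fin n)) : Set Plane :=
  Sym2.lift ⟨fun u v : Fin n => segment ℝ (fanPoint u) (fanPoint v), fun _ _ => segment_symm ℝ _ _⟩ e

theorem exists_isFanEdge {n : ℕ} {e : Sym2 (Fin n)} (he : e ∈ (doubleFan n).edgeSet) :
    ∃ u v : Fin n, IsFanEdge u v ∧ e = s(u, v) := by
  induction e with
  | _ u v =>
    rcases doubleFan_adj_cases he with h | h
    · exact ⟨u, v, h, rfl⟩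
    · exact ⟨v, u, h, Sym2.eq_swap⟩

/-- The drawing of the double fan with straight edges. -/
noncomputable def doubleFanDrawing (n : ℕ) : PlaneDrawing (doubleFan n) where
  pt k := fanPoint k
  pt_injective := fanPoint_injective.comp Fin.val_injective
  arc e := fanSegment e.1
  arc_isArc u v h := by
    refine ⟨Path.segment _ _, fun s t e => ?_, Path.range_segment _ _⟩
    have hne : fanPoint u ≠ fanPoint v := fun e => h.1 (Fin.ext (fanPoint_injective e))
    exact Subtype.ext (AffineMap.lineMap_injective ℝ hne e)
  mem_of_pt_mem_arc := by
    rintro ⟨e, he⟩ w hw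
    obtain ⟨u, v, huv, rfl⟩ := exists_isFanEdge he
    rcases eq_or_eq_of_fanPoint_mem huv hw with h | h
    · exact Sym2.mem_iff.2 (.inl (Fin.ext h))
    · exact Sym2.mem_iff.2 (.inr (Fin.ext h))
  arc_inter_arc := by
    rintro ⟨e, he⟩ ⟨f, hf⟩ hef p ⟨hp, hp'⟩
    obtain ⟨a, b, hab, rfl⟩ := exists_isFanEdge he
    obtain ⟨c, d, hcd, rfl⟩ := exists_isFanEdge hf
    have hne : ¬ (a.val = c.val ∧ b.val = d.val) := by
      rintro ⟨h1, h2⟩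
      obtain rfl := Fin.ext h1
      obtain rfl := Fin.ext h2
      exact hef rfl
    rcases mem_vertex_of_mem_edges hab hcd hne hp hp' with rfl | rfl
    · exact ⟨a, rfl⟩
    · exact ⟨b, rfl⟩

/-! ### The faces of the drawing of the double fan -/

theorem segment_subset_support {n : ℕ} {u v : Fin n} (h : (doubleFan n).Adj u v) :
    segment ℝ (fanPoint u) (fanPoint v) ⊆ (doubleFanDrawing n).support :=
  fun _ hp => .inr (Set.mem_iUnion.2 ⟨⟨s(u, v), h⟩, hp⟩)

/-- A point of the drawing lies on the edge between `0` and `1`, on an edge from one of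
these to the path, or on an edge of the path. -/
theorem cases_of_mem_support {n : ℕ} (hn : 3 ≤ n) {p : Plane}
    (hp : p ∈ (doubleFanDrawing n).support) :
    (p 1 = 0 ∧ -1 ≤ p 0 ∧ p 0 ≤ 1) ∨
    (∃ h k : ℕ, h ≤ 1 ∧ 2 ≤ k ∧ k < n ∧ p 1 = ((k : ℝ) - 1) * (1 - (2 * (h : ℝ) - 1) * p 0) ∧
        0 ≤ (2 * (h : ℝ) - 1) * p 0 ∧ (2 * (h : ℝ) - 1) * p 0 ≤ 1) ∨
    (∃ k : ℕ, 2 ≤ k ∧ k + 1 < n ∧ p 0 = 0 ∧ (k : ℝ) - 1 ≤ p 1 ∧ p 1 ≤ k) := by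
  have hedge : ∀ u v : Fin n, IsFanEdge u v → p ∈ segment ℝ (fanPoint u) (fanPoint v) →
      (p 1 = 0 ∧ -1 ≤ p 0 ∧ p 0 ≤ 1) ∨
      (∃ h k : ℕ, h ≤ 1 ∧ 2 ≤ k ∧ k < n ∧ p 1 = ((k : ℝ) - 1) * (1 - (2 * (h : ℝ) - 1) * p 0) ∧
        0 ≤ (2 * (h : ℝ) - 1) * p 0 ∧ (2 * (h : ℝ) - 1) * p 0 ≤ 1) ∨
      (∃ k : ℕ, 2 ≤ k ∧ k + 1 < n ∧ p 0 = 0 ∧ (k : ℝ) - 1 ≤ p 1 ∧ p 1 ≤ k) := by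
    rintro ⟨u, hu⟩ ⟨v, hv⟩ huv hp
    simp only at huv hp
    rcases huv with ⟨rfl, rfl⟩ | ⟨ha, hb⟩ | ⟨ha, rfl⟩
    · exact .inl (mem_base_iff.1 hp)
    · exact .inr (.inl ⟨u, v, ha, hb, hv, (mem_spoke_iff ha hb).1 hp⟩)
    · exact .inr (.inr ⟨u, ha, hv, (mem_spine_iff ha).1 hp⟩)
  rcases hp with ⟨w, rfl⟩ | hp
  · rcases Nat.lt_or_ge w.val 2 with hw | hw
    · refine hedge w ⟨2, by omega⟩ (.inr (.inl ⟨by omega, le_rfl⟩)) (left_mem_segment ℝ _ _)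
    · refine hedge ⟨0, by omega⟩ w (.inr (.inl ⟨by simp, hw⟩)) (right_mem_segment ℝ _ _)
  · obtain ⟨⟨e, he⟩, hp⟩ := Set.mem_iUnion.1 hp
    obtain ⟨u, v, huv, rfl⟩ := exists_isFanEdge he
    exact hedge u v huv hp

/-- Barycentric coordinates for the triangle `0, 1, k`. -/
noncomputable def baseForms (k : ℕ) : Fin 3 → Plane →ᵃ[ℝ] ℝ :=
  ![Plane.affineForm (1 / 2) (-1 / 2) (-1 / (2 * ((k : ℝ) - 1))),
    Plane.affineForm (1 / 2) (1 / 2) (-1 / (2 * ((k : ℝ) - 1))),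
    Plane.affineForm 0 0 (1 / ((k : ℝ) - 1))]

/-- Barycentric coordinates for the triangle `h, k, k + 1`, where `h ∈ {0, 1}`. -/
noncomputable def sideForms (h k : ℕ) : Fin 3 → Plane →ᵃ[ℝ] ℝ :=
  ![Plane.affineForm 0 (2 * (h : ℝ) - 1) 0,
    Plane.affineForm k (-(k * (2 * (h : ℝ) - 1))) (-1),
    Plane.affineForm (-((k : ℝ) - 1)) (((k : ℝ) - 1) * (2 * (h : ℝ) - 1)) 1]

theorem isBarycentric_baseForms {k : ℕ} (hk : 2 ≤ k) :
    IsBarycentric ![fanPoint 0, fanPoint 1, fanPoint k] (baseForms k) := by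
  have hk' : (k : ℝ) - 1 ≠ 0 := by
    have : (2 : ℝ) ≤ k := by exact_mod_cast hk
    linarith
  refine ⟨fun i j => ?_, fun p => ?_, fun p => Plane.ext ?_ ?_⟩
  · fin_cases i <;> fin_cases j <;>
      simp [baseForms, fanPoint_x_of_le, fanPoint_y_of_le, fanPoint_x hk, fanPoint_y hk] <;>
      field_simp <;> norm_num
  · simp [baseForms]; field_simp; ring
  · simp [baseForms, fanPoint_x_of_le, fanPoint_x hk]; ring
  · simp [baseForms, fanPoint_y_of_le, fanPoint_y hk]; field_simp

theorem isBarycentric_sideForms {h k : ℕ} (hh : h ≤ 1) (hk : 2 ≤ k) :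
    IsBarycentric ![fanPoint h, fanPoint k, fanPoint (k + 1)] (sideForms h k) := by
  have hs := hub_sq hh
  have hk1 : 2 ≤ k + 1 := by omega
  have e1 := fanPoint_x_of_le hh
  have e2 := fanPoint_y_of_le hh
  have e3 := fanPoint_x hk1
  have e4 := fanPoint_y hk1
  push_cast at e4
  refine ⟨fun i j => ?_, fun p => ?_, fun p => Plane.ext ?_ ?_⟩
  · generalize hε : 2 * (h : ℝ) - 1 = ε at *
    fin_cases i <;> fin_cases j <;>
      simp [sideForms, hε, e1, e2, e3, e4, fanPoint_x hk, fanPoint_y hk] <;>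
      first
      | linear_combination hs
      | linear_combination (-(k : ℝ)) * hs
      | linear_combination ((k : ℝ) - 1) * hs
  · simp [sideForms]; ring
  · simp [sideForms, e1, e3, fanPoint_x hk]
    linear_combination (p 0) * hs
  · simp [sideForms, e2, e4, fanPoint_y hk]; ring

theorem baseForms_pos_iff {p : Plane} :
    (∀ i, 0 < baseForms 2 i p) ↔ 0 < p 1 ∧ p 1 < 1 - p 0 ∧ p 1 < 1 + p 0 := by
  have e0 : baseForms 2 0 p = (1 - p 0 - p 1) / 2 := by simp [baseForms]; ring
  have e1 : baseForms 2 1 p = (1 + p 0 - p 1) / 2 := by simp [baseForms]; ring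
  have e2 : baseForms 2 2 p = p 1 := by simp [baseForms]; norm_num
  have : (∀ i, 0 < baseForms 2 i p) ↔
      0 < baseForms 2 0 p ∧ 0 < baseForms 2 1 p ∧ 0 < baseForms 2 2 p := by
    simp [Fin.forall_fin_succ]
  rw [this, e0, e1, e2]
  constructor
  · rintro ⟨h0, h1, h2⟩; refine ⟨by linarith, by linarith, by linarith⟩
  · rintro ⟨h0, h1, h2⟩; refine ⟨by linarith, by linarith, by linarith⟩

theorem exists_baseForms_neg_iff {k : ℕ} (hk : 2 ≤ k) {p : Plane} :
    (∃ i, baseForms k i p < 0) ↔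
      ((k : ℝ) - 1) * (1 - p 0) < p 1 ∨ ((k : ℝ) - 1) * (1 + p 0) < p 1 ∨ p 1 < 0 := by
  have hk' : 0 < (k : ℝ) - 1 := by
    have : (2 : ℝ) ≤ k := by exact_mod_cast hk
    linarith
  have e0 : baseForms k 0 p = (((k : ℝ) - 1) * (1 - p 0) - p 1) / (2 * ((k : ℝ) - 1)) := by
    simp [baseForms]; field_simp; ring
  have e1 : baseForms k 1 p = (((k : ℝ) - 1) * (1 + p 0) - p 1) / (2 * ((k : ℝ) - 1)) := by
    simp [baseForms]; field_simp; ring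
  have e2 : baseForms k 2 p = p 1 / ((k : ℝ) - 1) := by
    simp [baseForms]; field_simp
  have : (∃ i, baseForms k i p < 0) ↔
      baseForms k 0 p < 0 ∨ baseForms k 1 p < 0 ∨ baseForms k 2 p < 0 := by
    simp [Fin.exists_fin_succ]
  rw [this, e0, e1, e2, div_lt_iff₀ (by linarith), div_lt_iff₀ (by linarith), div_lt_iff₀ hk']
  simp only [zero_mul, sub_neg]

theorem sideForms_pos_iff {h k : ℕ} {p : Plane} :
    (∀ i, 0 < sideForms h k i p) ↔ 0 < (2 * (h : ℝ) - 1) * p 0 ∧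
      ((k : ℝ) - 1) * (1 - (2 * (h : ℝ) - 1) * p 0) < p 1 ∧
      p 1 < k * (1 - (2 * (h : ℝ) - 1) * p 0) := by
  have e0 : sideForms h k 0 p = (2 * (h : ℝ) - 1) * p 0 := by simp [sideForms]
  have e1 : sideForms h k 1 p = k * (1 - (2 * (h : ℝ) - 1) * p 0) - p 1 := by
    simp [sideForms]; ring
  have e2 : sideForms h k 2 p = p 1 - ((k : ℝ) - 1) * (1 - (2 * (h : ℝ) - 1) * p 0) := by
    simp [sideForms]; ring
  have : (∀ i, 0 < sideForms h k i p) ↔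
      0 < sideForms h k 0 p ∧ 0 < sideForms h k 1 p ∧ 0 < sideForms h k 2 p := by
    simp [Fin.forall_fin_succ]
  rw [this, e0, e1, e2]
  constructor
  · rintro ⟨h0, h1, h2⟩; refine ⟨by linarith, by linarith, by linarith⟩
  · rintro ⟨h0, h1, h2⟩; refine ⟨by linarith, by linarith, by linarith⟩

theorem baseForms_pos_subset {n : ℕ} (hn : 3 ≤ n) :
    {p | ∀ i, 0 < baseForms 2 i p} ⊆ (doubleFanDrawing n).supportᶜ := by
  intro p hp hps
  obtain ⟨h0, h1, h2⟩ := baseForms_pos_iff.1 hp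
  rcases cases_of_mem_support hn hps with ⟨hy, -⟩ | ⟨h, k, hh, hk, -, hy, hx0, hx1⟩ |
    ⟨k, hk, -, hx, hy, -⟩
  · linarith
  · have hk' : (2 : ℝ) ≤ k := by exact_mod_cast hk
    have : 1 - (2 * (h : ℝ) - 1) * p 0 ≤ p 1 := by
      rw [hy]
      nlinarith
    interval_cases h <;> norm_num at this <;> linarith
  · have hk' : (2 : ℝ) ≤ k := by exact_mod_cast hk
    rw [hx] at h1
    linarith

theorem baseForms_neg_subset {n : ℕ} (hn : 3 ≤ n) :
    {p | ∃ i, baseForms (n - 1) i p < 0} ⊆ (doubleFanDrawing n).supportᶜ := by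
  intro p hp hps
  have hp := (exists_baseForms_neg_iff (by omega)).1 hp
  rw [Nat.cast_sub (by omega), Nat.cast_one] at hp
  have hn' : (3 : ℝ) ≤ n := by exact_mod_cast hn
  rcases cases_of_mem_support hn hps with ⟨hy, hx0, hx1⟩ | ⟨h, k, hh, hk, hkn, hy, hx0, hx1⟩ |
    ⟨k, hk, hkn, hx, hy, hy'⟩
  · rw [hy] at hp
    rcases hp with hp | hp | hp <;> nlinarith
  · have hk' : (2 : ℝ) ≤ k := by exact_mod_cast hk
    have hkn' : (k : ℝ) + 1 ≤ n := by exact_mod_cast hkn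
    have h0 : 0 ≤ p 1 := by rw [hy]; exact mul_nonneg (by linarith) (by linarith)
    have h1 : p 1 ≤ ((n : ℝ) - 2) * (1 - (2 * (h : ℝ) - 1) * p 0) := by
      rw [hy]
      exact mul_le_mul_of_nonneg_right (by linarith) (by linarith)
    interval_cases h <;> norm_num at hx0 hx1 h1 <;> rcases hp with hp | hp | hp <;> nlinarith
  · have hk' : (2 : ℝ) ≤ k := by exact_mod_cast hk
    have hkn' : (k : ℝ) + 2 ≤ n := by exact_mod_cast hkn
    rw [hx] at hp
    rcases hp with hp | hp | hp <;> linarith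

theorem sideForms_pos_subset {n h k : ℕ} (hn : 3 ≤ n) (hh : h ≤ 1) (hk : 2 ≤ k) :
    {p | ∀ i, 0 < sideForms h k i p} ⊆ (doubleFanDrawing n).supportᶜ := by
  intro p hp hps
  obtain ⟨h0, h1, h2⟩ := sideForms_pos_iff.1 hp
  have hk' : (2 : ℝ) ≤ k := by exact_mod_cast hk
  have hpos : 0 < 1 - (2 * (h : ℝ) - 1) * p 0 := by nlinarith
  rcases cases_of_mem_support hn hps with ⟨hy, -⟩ | ⟨h', l, hh', hl, -, hy, hx0, hx1⟩ |
    ⟨l, hl, -, hx, -⟩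
  · have : 0 < ((k : ℝ) - 1) * (1 - (2 * (h : ℝ) - 1) * p 0) := mul_pos (by linarith) hpos
    linarith
  · have e : h = h' := by
      by_contra hne
      have : 2 * (h' : ℝ) - 1 = -(2 * (h : ℝ) - 1) := by
        interval_cases h <;> interval_cases h' <;> first | exact absurd rfl hne | norm_num
      rw [this] at hx0
      linarith
    subst e
    rw [hy] at h1 h2
    have h1 := lt_of_mul_lt_mul_right h1 hpos.le
    have h2 := lt_of_mul_lt_mul_right h2 hpos.le
    have h1 : k < l := by
      have : (k : ℝ) < l := by linarith
      exact_mod_cast this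
    have h2 : l < k + 1 := by
      have : (l : ℝ) < k + 1 := by linarith
      exact_mod_cast this
    omega
  · rw [hx] at h0
    simp at h0

/-- The open triangles together with the exterior of the triangle `0, 1, n - 1` cover the complement
of the drawing. -/
theorem cases_of_notMem_support {n : ℕ} (hn : 3 ≤ n) {p : Plane}
    (hp : p ∉ (doubleFanDrawing n).support) :
    (∀ i, 0 < baseForms 2 i p) ∨ (∃ i, baseForms (n - 1) i p < 0) ∨
      ∃ h k, h ≤ 1 ∧ 2 ≤ k ∧ k + 1 < n ∧ ∀ i, 0 < sideForms h k i p := by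
  rw [baseForms_pos_iff, exists_baseForms_neg_iff (by omega), Nat.cast_sub (by omega),
    Nat.cast_one]
  simp only [sideForms_pos_iff]
  by_contra! hcon
  obtain ⟨hO, ⟨hE0, hE1, hE2⟩, hS⟩ := hcon
  have hn' : (3 : ℝ) ≤ n := by exact_mod_cast hn
  have hbase : ¬ (p 1 = 0 ∧ -1 ≤ p 0 ∧ p 0 ≤ 1) := fun h =>
    hp (segment_subset_support (u := ⟨0, by omega⟩) (v := ⟨1, by omega⟩)
      (IsFanEdge.adj (.inl ⟨rfl, rfl⟩)) (mem_base_iff.2 h))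
  have hx0 : -1 ≤ p 0 := by nlinarith
  have hx1 : p 0 ≤ 1 := by nlinarith
  have hy : 0 < p 1 := lt_of_le_of_ne hE2 fun e => hbase ⟨e.symm, hx0, hx1⟩
  -- the side of the vertical axis on which `p` lies
  obtain ⟨h, hh, hε0⟩ : ∃ h : ℕ, h ≤ 1 ∧ 0 ≤ (2 * (h : ℝ) - 1) * p 0 := by
    rcases le_total 0 (p 0) with hx | hx
    · exact ⟨1, le_rfl, by norm_num; exact hx⟩
    · exact ⟨0, by omega, by norm_num; exact hx⟩
  have hEh : p 1 ≤ ((n : ℝ) - 2) * (1 - (2 * (h : ℝ) - 1) * p 0) := by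
    interval_cases h <;> norm_num <;> linarith
  have hOh : 1 - (2 * (h : ℝ) - 1) * p 0 ≤ p 1 := by
    by_contra! hlt
    have h1 : p 1 < 1 - p 0 := by interval_cases h <;> norm_num at hlt hε0 <;> linarith
    have h2 : p 1 < 1 + p 0 := by interval_cases h <;> norm_num at hlt hε0 <;> linarith
    exact absurd (hO hy h1) (not_le.2 h2)
  have hpos : 0 < 1 - (2 * (h : ℝ) - 1) * p 0 := by
    by_contra! hle
    nlinarith
  have hspoke : ∀ k : ℕ, 2 ≤ k → k < n →
      p 1 ≠ ((k : ℝ) - 1) * (1 - (2 * (h : ℝ) - 1) * p 0) := fun k hk hkn e =>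
    hp (segment_subset_support (u := ⟨h, by omega⟩) (v := ⟨k, hkn⟩)
      (IsFanEdge.adj (.inr (.inl ⟨hh, hk⟩))) ((mem_spoke_iff hh hk).2 ⟨e, hε0, by linarith⟩))
  -- the ratio `s` tells between which two edges at the vertex `h` the point `p` lies
  obtain ⟨s, hs⟩ : ∃ s, p 1 = s * (1 - (2 * (h : ℝ) - 1) * p 0) :=
    ⟨_, (div_mul_cancel₀ _ hpos.ne').symm⟩
  have hs1 : 1 ≤ s := by
    rw [hs] at hOh
    exact le_of_mul_le_mul_right (by linarith) hpos
  have hsn : s ≤ (n : ℝ) - 2 := by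
    rw [hs] at hEh
    exact le_of_mul_le_mul_right hEh hpos
  have hfl : (⌊s⌋₊ : ℝ) ≤ s := Nat.floor_le (by linarith)
  have hfl' : s < ⌊s⌋₊ + 1 := Nat.lt_floor_add_one s
  have hf1 : 1 ≤ ⌊s⌋₊ := Nat.le_floor (by exact_mod_cast hs1)
  generalize ⌊s⌋₊ = j at hfl hfl' hf1
  have hjn : j + 2 ≤ n := by
    have : (j : ℝ) + 2 ≤ n := by linarith
    exact_mod_cast this
  have hjs : (j : ℝ) ≠ s := by
    intro e
    refine hspoke (j + 1) (by omega) (by omega) ?_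
    rw [hs, ← e]
    push_cast
    ring
  have hjs : (j : ℝ) < s := lt_of_le_of_ne hfl hjs
  have hjn' : j + 2 < n := by
    refine lt_of_le_of_ne hjn fun e => ?_
    have : (j : ℝ) + 2 = n := by exact_mod_cast e
    linarith
  rcases hε0.lt_or_eq with hε | hε
  · have := hS h (j + 1) hh (by omega) (by omega) hε (by
      rw [hs]; push_cast
      exact mul_lt_mul_of_pos_right (by linarith) hpos)
    rw [hs] at this
    push_cast at this
    have := le_of_mul_le_mul_right this hpos
    linarith
  · have hx : p 0 = 0 := by
      have := hub_sq hh
      linear_combination (-p 0) * this - (2 * (h : ℝ) - 1) * hε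
    rw [hx] at hs
    refine hp (segment_subset_support (u := ⟨j + 1, by omega⟩) (v := ⟨j + 1 + 1, by omega⟩)
      (IsFanEdge.adj (.inr (.inr ⟨?_, rfl⟩))) ((mem_spine_iff ?_).2 ⟨hx, ?_, ?_⟩))
    · simp; omega
    · simp; omega
    · push_cast; linarith
    · push_cast; linarith

/-- A connected region outside the drawing whose frontier consists of the three edges of a triangle
of the graph is a face bounded by that triangle. -/
theorem isBoundedByTriangle_of_frontier {n : ℕ} {F : Set Plane} {u v w : Fin n}
    (huv : (doubleFan n).Adj u v) (hvw : (doubleFan n).Adj v w) (hwu : (doubleFan n).Adj w u)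
    (hF : IsPreconnected F) (hFD : F ⊆ (doubleFanDrawing n).supportᶜ)
    (hfr : frontier F = segment ℝ (fanPoint u) (fanPoint v) ∪
      segment ℝ (fanPoint v) (fanPoint w) ∪ segment ℝ (fanPoint w) (fanPoint u))
    {p : Plane} (hp : p ∈ F) : (doubleFanDrawing n).IsBoundedByTriangle
      (connectedComponentIn (doubleFanDrawing n).supportᶜ p) := by
  rw [connectedComponentIn_compl_eq hF hFD ?_ hp]
  · exact ⟨u, v, w, huv, hvw, hwu, hfr⟩
  · rw [hfr]
    exact Set.union_subset (Set.union_subset (segment_subset_support huv)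
      (segment_subset_support hvw)) (segment_subset_support hwu)

theorem isSphereTriangulation_doubleFan {n : ℕ} (hn : 3 ≤ n) :
    IsSphereTriangulation (doubleFan n) := by
  refine ⟨doubleFanDrawing n, ?_⟩
  rintro _ ⟨p, hp, rfl⟩
  let v₀ : Fin n := ⟨0, by omega⟩
  let v₁ : Fin n := ⟨1, by omega⟩
  have h01 : (doubleFan n).Adj v₀ v₁ := IsFanEdge.adj (.inl ⟨rfl, rfl⟩)
  have hspoke : ∀ h k : Fin n, h.val ≤ 1 → 2 ≤ k.val → (doubleFan n).Adj h k :=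
    fun h k hh hk => IsFanEdge.adj (.inr (.inl ⟨hh, hk⟩))
  rcases cases_of_notMem_support hn hp with h | h | ⟨h, k, hh, hk, hkn, hpk⟩
  · let v₂ : Fin n := ⟨2, by omega⟩
    exact isBoundedByTriangle_of_frontier h01 (hspoke v₁ v₂ le_rfl le_rfl)
      (hspoke v₀ v₂ zero_le_one le_rfl).symm IsBarycentric.isPreconnected_pos
      (baseForms_pos_subset hn) (isBarycentric_baseForms le_rfl).frontier_pos h
  · let w : Fin n := ⟨n - 1, by omega⟩
    have hw : 2 ≤ n - 1 := by omega
    exact isBoundedByTriangle_of_frontier h01 (hspoke v₁ w le_rfl hw)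
      (hspoke v₀ w zero_le_one hw).symm (isBarycentric_baseForms hw).isPreconnected_neg
      (baseForms_neg_subset hn) (isBarycentric_baseForms hw).frontier_neg h
  · let u : Fin n := ⟨h, by omega⟩
    let v : Fin n := ⟨k, by omega⟩
    let w : Fin n := ⟨k + 1, hkn⟩
    exact isBoundedByTriangle_of_frontier (hspoke u v hh hk) (IsFanEdge.adj (.inr (.inr ⟨hk, rfl⟩)))
      (hspoke u w hh (by simp [w]; omega)).symm IsBarycentric.isPreconnected_pos
      (sideForms_pos_subset hn hh hk) (isBarycentric_sideForms hh hk).frontier_pos hpk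

/-! ### The triangles of the double fan -/

theorem le_numThreeCliques_doubleFan {n : ℕ} (hn : 3 ≤ n) :
    3 * n - 8 ≤ numThreeCliques (doubleFan n) := by
  classical
  let F : Fin (n - 2) ⊕ Fin 2 × Fin (n - 3) → Finset (Fin n) := Sum.elim
    (fun i => {⟨0, by omega⟩, ⟨1, by omega⟩, ⟨i + 2, by omega⟩})
    (fun q => {⟨q.1, by omega⟩, ⟨q.2 + 2, by omega⟩, ⟨q.2 + 3, by omega⟩})
  have hF : ∀ q ∈ Set.univ, F q ∈ (doubleFan n).cliqueSet 3 := by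
    rintro (i | ⟨h, i⟩) - <;> rw [SimpleGraph.mem_cliqueSet_iff, SimpleGraph.is3Clique_iff] <;>
      refine ⟨_, _, _, ?_, ?_, ?_, rfl⟩ <;> refine IsFanEdge.adj ?_ <;> unfold IsFanEdge <;>
      simp <;> omega
  have hinj : Set.InjOn F Set.univ := by
    rintro (i | ⟨h, i⟩) - (j | ⟨l, j⟩) - e <;> have e := fun z => Finset.ext_iff.1 e z <;>
      simp only [F, Sum.elim_inl, Sum.elim_inr, Finset.mem_insert, Finset.mem_singleton,
        Fin.ext_iff] at e
    · have := (e ⟨i + 2, by omega⟩).1 (by simp)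
      simp at this
      rw [Fin.ext this]
    · have h0 := (e ⟨0, by omega⟩).1 (by simp)
      have h1 := (e ⟨1, by omega⟩).1 (by simp)
      simp only at h0 h1
      omega
    · have h0 := (e ⟨0, by omega⟩).2 (by simp)
      have h1 := (e ⟨1, by omega⟩).2 (by simp)
      simp only at h0 h1
      omega
    · have h0 := (e ⟨h, by omega⟩).1 (by simp)
      have h1 := (e ⟨i + 2, by omega⟩).1 (by simp)
      have h2 := (e ⟨j + 2, by omega⟩).2 (by simp)
      simp only at h0 h1 h2
      have hhl : h = l := Fin.ext (by omega)
      have hij : i = j := Fin.ext (by omega)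
      rw [hhl, hij]
  have := Set.ncard_le_ncard_of_injOn F hF hinj (Set.toFinite _)
  rw [Set.ncard_univ] at this
  simp only [Nat.card_eq_fintype_card, Fintype.card_sum, Fintype.card_prod, Fintype.card_fin]
    at this
  unfold numThreeCliques
  omega

/-- A further edge would form an additional triangle with the vertex `0`, which is adjacent to all
the others. -/
theorem isMaximalPlanarGraph_doubleFan {n : ℕ} (hn : 3 ≤ n) :
    IsMaximalPlanarGraph (doubleFan n) := by
  classical
  refine ⟨⟨doubleFanDrawing n⟩, fun H hH hle u v huv => ?_⟩
  by_contra hnot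
  have hup := IsPlanarGraph.numThreeCliques_le hH (by simpa using hn)
  rw [Nat.card_fin] at hup
  have hlow := le_numThreeCliques_doubleFan hn
  have hdom : ∀ w : Fin n, w.val ≠ 0 → (doubleFan n).Adj ⟨0, by omega⟩ w :=
    fun w hw => ⟨fun e => hw (by rw [← e]), .inl (by simp)⟩
  have hu : u.val ≠ 0 := fun e => hnot ⟨huv.ne, .inl (by omega)⟩
  have hv : v.val ≠ 0 := fun e => hnot ⟨huv.ne, .inr (.inl (by omega))⟩
  have hlt : ((doubleFan n).cliqueSet 3).ncard < (H.cliqueSet 3).ncard := by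
    refine Set.ncard_lt_ncard ⟨fun t ht => ?_, fun hsub => ?_⟩ (Set.toFinite _)
    · exact SimpleGraph.IsNClique.mono hle ht
    · have ht : {⟨0, by omega⟩, u, v} ∈ H.cliqueSet 3 :=
        SimpleGraph.is3Clique_iff.2 ⟨_, _, _, hle (hdom u hu), hle (hdom v hv), huv, rfl⟩
      have := SimpleGraph.mem_cliqueSet_iff.1 (hsub ht)
      exact hnot (this.isClique (by simp) (by simp) huv.ne)
  unfold numThreeCliques at hup hlow
  omega

theorem theorem2 (n : ℕ) (hn : 3 ≤ n) :
    (∀ (V : Type*) [Finite V] (G : SimpleGraph V), Nat.card V = n →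
      IsMaximalPlanarGraph G ∨ IsSphereTriangulation G → numThreeCliques G ≤ 3 * n - 8) ∧
    ∃ G : SimpleGraph (Fin n),
      IsMaximalPlanarGraph G ∧ IsSphereTriangulation G ∧ numThreeCliques G = 3 * n - 8 := by
  have hup : ∀ (V : Type _) [Finite V] (G : SimpleGraph V), Nat.card V = n →
      IsMaximalPlanarGraph G ∨ IsSphereTriangulation G → numThreeCliques G ≤ 3 * n - 8 := by
    rintro V _ G rfl hG
    refine IsPlanarGraph.numThreeCliques_le ?_ hn
    rcases hG with hG | ⟨D, -⟩
    · exact hG.prop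
    · exact ⟨D⟩
  refine ⟨hup, doubleFan n, isMaximalPlanarGraph_doubleFan hn,
    isSphereTriangulation_doubleFan hn, ?_⟩
  refine le_antisymm ?_ (le_numThreeCliques_doubleFan hn)
  simpa using IsPlanarGraph.numThreeCliques_le ⟨doubleFanDrawing n⟩ (by simpa using hn)
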